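/- **Setting.** Let $\mathbf O$ be the real octonions with conjugation $x\mapsto\overline x$, Euclidean inner product $(x|y)$, and ${\rm Im}\,\mathbf O=\{p\in\mathbf O:\overline p=-p\}$. Let $\mathcal J^1$ be the real Jordan algebra of the matrices $$h^1(\xi_1,\xi_2,\xi_3;x_1,x_2,x_3)=\begin{pmatrix}\xi_1&\sqrt{-1}\,x_3&\sqrt{-1}\,\overline{x_2}\\ \sqrt{-1}\,\overline{x_3}&\xi_2&x_1\\ \sqrt{-1}\,x_2&\overline{x_1}&\xi_3\end{pmatrix}\qquad(\xi_i\in\mathbb R,\ x_i\in\mathbf O)$$ with product $X\circ Y=\frac12(XY+YX)$. Let $G={\rm F}_{4(-20)}=\{g\in{\rm GL}_{\mathbb R}(\mathcal J^1): g(X\circ Y)=gX\circ gY\}$, let $\sigma\in G$ be the involution $h^1(\xi_1,\xi_2,\xi_3;x_1,x_2,x_3)\mapsto h^1(\xi_1,\xi_2,\xi_3;x_1,-x_2,-x_3)$, and let $K=\{g\in G:\sigma g\sigma^{-1}=g\}$. For $a\in\mathbf O$ and $p\in{\rm Im}\,\mathbf O$ let $\tilde A^1_i(a)$ and $\delta(p)$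 be the derivations of $\mathcal J^1$ that send $h^1(\xi_1,\xi_2,\xi_3;x_1,x_2,x_3)$ to $$\begin{aligned} \tilde A_1^1(a):\ & h^1\bigl(0,\,2(a|x_1),\,-2(a|x_1);\ -(\xi_2-\xi_3)a,\ -\overline{x_3a},\ \overline{ax_2}\bigr),\\ \tilde A_2^1(a):\ & h^1\bigl(2(a|x_2),\,0,\,-2(a|x_2);\ -\overline{ax_3},\ -(\xi_3-\xi_1)a,\ -\overline{x_1a}\bigr),\\ \tilde A_3^1(a):\ & h^1\bigl(-2(a|x_3),\,2(a|x_3),\,0;\ \overline{x_2a},\ \overline{ax_1},\ -(\xi_1-\xi_2)a\bigr),\\ \delta(p):\ & h^1\bigl(0,0,0;\ px_1,\ x_2p,\ -(px_3+x_3p)\bigr). \end{aligned}$$ For $x\in\mathbf O$ and $p\in{\rm Im}\,\mathbf O$ put $\mathcal G_{\pm1}(x)=\tilde A_1^1(x)+\tilde A_2^1(\mp\overline x)$ and $\mathcal G_{\pm2}(p)=\tilde A_3^1(\mp p)-\delta(p)$; these are the elements of the root spaces $\mathfrak g_{\pm\alpha}$ and $\mathfrak g_{\pm2\alpha}$ of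 $(\mathfrak f_{4(-20)},\mathfrak a)$, where $\mathfrak a=\mathbb R\tilde A_3^1(1)$ and $\alpha(\tilde A_3^1(1))=1$. Put $a_t=\exp(t\tilde A_3^1(1))$ and $N^\pm=\{\exp(\mathcal G_{\pm1}(x)+\mathcal G_{\pm2}(p)):x\in\mathbf O,\ p\in{\rm Im}\,\mathbf O\}$. For $g\in G$, the Iwasawa component $H(g)\in\mathfrak a$ is the unique element of $\mathfrak a$ with $g\in K\,\exp(H(g))\,N^+$. **Lemma.** Let $t\in\mathbb R$, $p\in{\rm Im}\,\mathbf O$, $x\in\mathbf O$, and let $z=\exp(\mathcal G_{-2}(p)+\mathcal G_{-1}(x))\in N^-$. Then $a_tz$ and $z$ lie in $G$, $H(a_tz)$ and $H(z)$ are well defined (existence and uniqueness), and $$\begin{aligned} (1)\quad H(a_tz)&=\tfrac12\log\Bigl(e^{-2t}\bigl((e^{2t}+(x|x))^2+4(p|p)\bigr)\Bigr)\tilde A_3^1(1),\\ (2)\quad H(z)&=\tfrac12\log\bigl((1+(x|x))^2+4(p|p)\bigr)\tilde A_3^1(1). \end{aligned}$$ -/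

import Mathlib

namespace F4Iwasawa

open scoped Quaternion

/-! ### The octonions -/

/-- The octonions over a commutative ring `R`, as the Cayley-Dickson double of the quaternions.
The algebra `𝐎` of the (real, division) octonions is `Octonion ℝ`. -/
def Octonion (R : Type) [CommRing R] : Type := ℍ[R] × ℍ[R]

namespace Octonion

variable {R : Type} [CommRing R]

instance : AddCommGroup (Octonion R) := inferInstanceAs (AddCommGroup (ℍ[R] × ℍ[R]))
instance : Module R (Octonion R) := inferInstanceAs (Module R (ℍ[R] × ℍ[R]))
instance : Module.Finite R (Octonion R) := inferInstanceAs (Module.Finite R (ℍ[R] × ℍ[R]))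

@[ext] theorem ext {x y : Octonion R} (h₁ : x.1 = y.1) (h₂ : x.2 = y.2) : x = y :=
  Prod.ext h₁ h₂

/-- The Cayley-Dickson product `(a, b) (c, d) = (a c - d̄ b, d a + b c̄)`. -/
instance : Mul (Octonion R) :=
  ⟨fun x y => (x.1 * y.1 - star y.2 * x.2, y.2 * x.1 + x.2 * star y.1)⟩

instance : One (Octonion R) := ⟨((1 : ℍ[R]), (0 : ℍ[R]))⟩

/-- The conjugation `x ↦ x̄`, `(a, b) ↦ (ā, -b)`. -/
instance : Star (Octonion R) := ⟨fun x => (star x.1, -x.2)⟩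

@[simp] theorem zero_fst : (0 : Octonion R).1 = 0 := rfl
@[simp] theorem zero_snd : (0 : Octonion R).2 = 0 := rfl
@[simp] theorem one_fst : (1 : Octonion R).1 = 1 := rfl
@[simp] theorem one_snd : (1 : Octonion R).2 = 0 := rfl
@[simp] theorem add_fst (x y : Octonion R) : (x + y).1 = x.1 + y.1 := rfl
@[simp] theorem add_snd (x y : Octonion R) : (x + y).2 = x.2 + y.2 := rfl
@[simp] theorem neg_fst (x : Octonion R) : (-x).1 = -x.1 := rfl
@[simp] theorem neg_snd (x : Octonion R) : (-x).2 = -x.2 := rfl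
@[simp] theorem sub_fst (x y : Octonion R) : (x - y).1 = x.1 - y.1 := rfl
@[simp] theorem sub_snd (x y : Octonion R) : (x - y).2 = x.2 - y.2 := rfl
@[simp] theorem smul_fst (r : R) (x : Octonion R) : (r • x).1 = r • x.1 := rfl
@[simp] theorem smul_snd (r : R) (x : Octonion R) : (r • x).2 = r • x.2 := rfl
@[simp] theorem mul_fst (x y : Octonion R) : (x * y).1 = x.1 * y.1 - star y.2 * x.2 := rfl
@[simp] theorem mul_snd (x y : Octonion R) : (x * y).2 = y.2 * x.1 + x.2 * star y.1 := rfl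
@[simp] theorem star_fst (x : Octonion R) : (star x).1 = star x.1 := rfl
@[simp] theorem star_snd (x : Octonion R) : (star x).2 = -x.2 := rfl

instance : NonAssocRing (Octonion R) :=
  { (inferInstance : AddCommGroup (Octonion R)), (inferInstance : Mul (Octonion R)),
    (inferInstance : One (Octonion R)) with
    left_distrib := fun x y z => by
      apply Octonion.ext <;> simp [mul_add, add_mul] <;> abel
    right_distrib := fun x y z => by
      apply Octonion.ext <;> simp [mul_add, add_mul] <;> abel
    zero_mul := fun x => by apply Octonion.ext <;> simp
    mul_zero := fun x => by apply Octonion.ext <;> simp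
    one_mul := fun x => by apply Octonion.ext <;> simp
    mul_one := fun x => by apply Octonion.ext <;> simp }

instance : IsScalarTower R (Octonion R) (Octonion R) :=
  ⟨fun r x y => by apply Octonion.ext <;> simp [smul_sub, smul_add]⟩

instance : SMulCommClass R (Octonion R) (Octonion R) :=
  ⟨fun r x y => by apply Octonion.ext <;> simp [smul_sub, smul_add, Quaternion.star_smul]⟩

@[simp] theorem star_add' (x y : Octonion R) : star (x + y) = star x + star y := by
  apply Octonion.ext <;> simp [add_comm]

@[simp] theorem star_smul' (r : R) (x : Octonion R) : star (r • x) = r • star x := by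
  apply Octonion.ext <;> simp [Quaternion.star_smul]

/-- The Euclidean inner product `(x|y)` of the real octonions, in which the eight natural units
are orthonormal. -/
@[reducible] noncomputable def innerCore : InnerProductSpace.Core ℝ (Octonion ℝ) where
  inner x y :=
    x.1.re * y.1.re + x.1.imI * y.1.imI + x.1.imJ * y.1.imJ + x.1.imK * y.1.imK +
      (x.2.re * y.2.re + x.2.imI * y.2.imI + x.2.imJ * y.2.imJ + x.2.imK * y.2.imK)
  conj_inner_symm x y := by simp; ring
  re_inner_nonneg x := by
    simp only [RCLike.re_to_real]
    nlinarith [mul_self_nonneg x.1.re, mul_self_nonneg x.1.imI, mul_self_nonneg x.1.imJ,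
      mul_self_nonneg x.1.imK, mul_self_nonneg x.2.re, mul_self_nonneg x.2.imI,
      mul_self_nonneg x.2.imJ, mul_self_nonneg x.2.imK]
  add_left x y z := by simp; ring
  smul_left x y r := by simp; ring
  definite x h := by
    have h1 := mul_self_nonneg x.1.re
    have h2 := mul_self_nonneg x.1.imI
    have h3 := mul_self_nonneg x.1.imJ
    have h4 := mul_self_nonneg x.1.imK
    have h5 := mul_self_nonneg x.2.re
    have h6 := mul_self_nonneg x.2.imI
    have h7 := mul_self_nonneg x.2.imJ
    have h8 := mul_self_nonneg x.2.imK
    apply Octonion.ext <;> apply Quaternion.ext <;> apply mul_self_eq_zero.mp <;> linarith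

noncomputable instance : NormedAddCommGroup (Octonion ℝ) := innerCore.toNormedAddCommGroup
noncomputable instance : InnerProductSpace ℝ (Octonion ℝ) := .ofCore innerCore.toCore

theorem inner_def (x y : Octonion ℝ) : inner ℝ x y =
    x.1.re * y.1.re + x.1.imI * y.1.imI + x.1.imJ * y.1.imJ + x.1.imK * y.1.imK +
      (x.2.re * y.2.re + x.2.imI * y.2.imI + x.2.imJ * y.2.imJ + x.2.imK * y.2.imK) := rfl

/-- The vector part `Im 𝐎` of the octonions. -/
def Im : Set (Octonion ℝ) := {p | p.1.re = 0}

/-- The inclusion of the octonions into the complexified octonions. -/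
noncomputable def toComplex (x : Octonion ℝ) : Octonion ℂ :=
  ((⟨x.1.re, x.1.imI, x.1.imJ, x.1.imK⟩ : ℍ[ℂ]), (⟨x.2.re, x.2.imI, x.2.imJ, x.2.imK⟩ : ℍ[ℂ]))

@[simp] theorem toComplex_fst_re (x : Octonion ℝ) : x.toComplex.1.re = x.1.re := rfl
@[simp] theorem toComplex_fst_imI (x : Octonion ℝ) : x.toComplex.1.imI = x.1.imI := rfl
@[simp] theorem toComplex_fst_imJ (x : Octonion ℝ) : x.toComplex.1.imJ = x.1.imJ := rfl
@[simp] theorem toComplex_fst_imK (x : Octonion ℝ) : x.toComplex.1.imK = x.1.imK := rfl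
@[simp] theorem toComplex_snd_re (x : Octonion ℝ) : x.toComplex.2.re = x.2.re := rfl
@[simp] theorem toComplex_snd_imI (x : Octonion ℝ) : x.toComplex.2.imI = x.2.imI := rfl
@[simp] theorem toComplex_snd_imJ (x : Octonion ℝ) : x.toComplex.2.imJ = x.2.imJ := rfl
@[simp] theorem toComplex_snd_imK (x : Octonion ℝ) : x.toComplex.2.imK = x.2.imK := rfl

section Helpers

variable {R : Type} [CommRing R]

theorem star_sub' (x y : Octonion R) : star (x - y) = star x - star y := by
  apply Octonion.ext
  · simp
  · simp [sub_eq_add_neg, add_comm]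

theorem star_star' (x : Octonion R) : star (star x) = x := by
  apply Octonion.ext <;> simp

theorem star_mul' (x y : Octonion R) : star (x * y) = star y * star x := by
  apply Octonion.ext
  · simp
  · simp [add_comm]

end Helpers

theorem toComplex_add (x y : Octonion ℝ) : (x + y).toComplex = x.toComplex + y.toComplex := by
  apply Octonion.ext <;> apply Quaternion.ext <;> simp

theorem toComplex_sub (x y : Octonion ℝ) : (x - y).toComplex = x.toComplex - y.toComplex := by
  apply Octonion.ext <;> apply Quaternion.ext <;> simp

theorem toComplex_smul (r : ℝ) (x : Octonion ℝ) :
    (r • x).toComplex = (r : ℂ) • x.toComplex := by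
  apply Octonion.ext <;> apply Quaternion.ext <;> simp [-Complex.coe_smul]

theorem toComplex_star (x : Octonion ℝ) : (star x).toComplex = star x.toComplex := by
  apply Octonion.ext <;> apply Quaternion.ext <;> simp

theorem toComplex_mul (x y : Octonion ℝ) : (x * y).toComplex = x.toComplex * y.toComplex := by
  apply Octonion.ext <;> apply Quaternion.ext <;> simp

end Octonion

/-! ### The exceptional Jordan algebra -/

/-- The underlying real vector space of the Jordan algebra `𝒥¹`: the pair `(ξ, x)` stands for
`h¹(ξ₁, ξ₂, ξ₃; x₁, x₂, x₃)`, with indices shifted to `0, 1, 2`. -/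
abbrev J : Type := (Fin 3 → ℝ) × (Fin 3 → Octonion ℝ)

/-- The element `h¹(ξ₁, ξ₂, ξ₃; x₁, x₂, x₃)`. -/
def h1 (ξ₁ ξ₂ ξ₃ : ℝ) (x₁ x₂ x₃ : Octonion ℝ) : J := (![ξ₁, ξ₂, ξ₃], ![x₁, x₂, x₃])

/-- The matrix with entries in the complexified octonions which `h¹` abbreviates. -/
noncomputable def toMatrix (X : J) : Matrix (Fin 3) (Fin 3) (Octonion ℂ) :=
  !![((X.1 0 : ℝ) : ℂ) • (1 : Octonion ℂ), Complex.I • (X.2 2).toComplex,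
      Complex.I • star (X.2 1).toComplex;
    Complex.I • star (X.2 2).toComplex, ((X.1 1 : ℝ) : ℂ) • (1 : Octonion ℂ),
      (X.2 0).toComplex;
    Complex.I • (X.2 1).toComplex, star (X.2 0).toComplex,
      ((X.1 2 : ℝ) : ℂ) • (1 : Octonion ℂ)]

/-- The Jordan product of `𝒥¹` in coordinates; `toMatrix_jordan` says that it is
`X ∘ Y = (X Y + Y X) / 2` for the matrix product. -/
noncomputable def jordan (X Y : J) : J :=
  h1 (X.1 0 * Y.1 0 - inner ℝ (X.2 1) (Y.2 1) - inner ℝ (X.2 2) (Y.2 2))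
    (X.1 1 * Y.1 1 + inner ℝ (X.2 0) (Y.2 0) - inner ℝ (X.2 2) (Y.2 2))
    (X.1 2 * Y.1 2 + inner ℝ (X.2 0) (Y.2 0) - inner ℝ (X.2 1) (Y.2 1))
    ((1 / 2 : ℝ) • ((X.1 1 + X.1 2) • Y.2 0 + (Y.1 1 + Y.1 2) • X.2 0
      - star (X.2 1 * Y.2 2) - star (Y.2 1 * X.2 2)))
    ((1 / 2 : ℝ) • ((X.1 2 + X.1 0) • Y.2 1 + (Y.1 2 + Y.1 0) • X.2 1
      + star (X.2 2 * Y.2 0) + star (Y.2 2 * X.2 0)))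
    ((1 / 2 : ℝ) • ((X.1 0 + X.1 1) • Y.2 2 + (Y.1 0 + Y.1 1) • X.2 2
      + star (X.2 0 * Y.2 1) + star (Y.2 0 * X.2 1)))

theorem toMatrix_jordan (X Y : J) : toMatrix (jordan X Y) =
    (1 / 2 : ℂ) • (toMatrix X * toMatrix Y + toMatrix Y * toMatrix X) := by
  have key : ∀ x y : Octonion ℝ, ((inner ℝ x y : ℝ) : ℂ) • (1 : Octonion ℂ) =
      (1 / 2 : ℂ) • (x.toComplex * star y.toComplex + y.toComplex * star x.toComplex) := by
    intro x y
    apply Octonion.ext <;> apply Quaternion.ext <;>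
      simp [-Complex.coe_smul, Octonion.inner_def] <;> ring
  have key' : ∀ x y : Octonion ℝ, ((inner ℝ x y : ℝ) : ℂ) • (1 : Octonion ℂ) =
      (1 / 2 : ℂ) • (star x.toComplex * y.toComplex + star y.toComplex * x.toComplex) := by
    intro x y
    apply Octonion.ext <;> apply Quaternion.ext <;>
      simp [-Complex.coe_smul, Octonion.inner_def] <;> ring
  have hI : ∀ w : Octonion ℂ, Complex.I • Complex.I • w = -w := fun w => by
    rw [smul_smul, Complex.I_mul_I, neg_one_smul]
  apply Matrix.ext
  intro i j
  rw [Matrix.smul_apply, Matrix.add_apply, Matrix.mul_apply, Matrix.mul_apply,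
    Fin.sum_univ_three, Fin.sum_univ_three]
  fin_cases i <;> fin_cases j <;>
    simp only [toMatrix, jordan, h1, Matrix.of_apply, Matrix.cons_val, Fin.mk_zero, Fin.mk_one,
      Fin.reduceFinMk, Fin.isValue, Octonion.toComplex_add, Octonion.toComplex_sub,
      Octonion.toComplex_smul, Octonion.toComplex_mul, Octonion.toComplex_star, Octonion.star_mul',
      Octonion.star_add', Octonion.star_sub', Octonion.star_smul', Octonion.star_star',
      smul_mul_assoc, mul_smul_comm, hI, one_mul, mul_one,
      Complex.ofReal_add, Complex.ofReal_sub, Complex.ofReal_mul, sub_smul, add_smul]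
  · rw [key' (X.2 1) (Y.2 1), key (X.2 2) (Y.2 2)]
    module
  · module
  · module
  · module
  · rw [key (X.2 0) (Y.2 0), key' (X.2 2) (Y.2 2)]
    module
  · module
  · module
  · module
  · rw [key' (X.2 0) (Y.2 0), key (X.2 1) (Y.2 1)]
    module

/-! ### The group -/

/-- The general linear group of `𝒥¹` (every linear map of this finite-dimensional space is
continuous). -/
abbrev GLJ : Type := (J →L[ℝ] J)ˣ

/-- The exceptional Lie group `F₄₍₋₂₀₎`, the automorphism group of the Jordan algebra `𝒥¹`. -/
def F4 : Subgroup GLJ where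
  carrier := {g | ∀ X Y : J, g.1 (jordan X Y) = jordan (g.1 X) (g.1 Y)}
  mul_mem' {g h} hg hh X Y := by
    simp only [Set.mem_ofPred_eq] at hg hh
    simp [hg, hh]
  one_mem' X Y := by simp
  inv_mem' {g} hg X Y := by
    simp only [Set.mem_ofPred_eq] at hg
    have e : ∀ Z : J, g.1 ((g⁻¹).1 Z) = Z := fun Z =>
      congrArg (fun f : J →L[ℝ] J => f Z) g.mul_inv
    have e' : ∀ Z : J, (g⁻¹).1 (g.1 Z) = Z := fun Z =>
      congrArg (fun f : J →L[ℝ] J => f Z) g.inv_mul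
    have := hg ((g⁻¹).1 X) ((g⁻¹).1 Y)
    rw [e, e] at this
    rw [← this, e']

/-- The exponential of an endomorphism of `𝒥¹`, as an element of the general linear group. -/
noncomputable def expGL (φ : J →L[ℝ] J) : GLJ :=
  letI : NormedAlgebra ℚ (J →L[ℝ] J) := .restrictScalars ℚ ℝ (J →L[ℝ] J)
  (NormedSpace.isUnit_exp φ).unit

/-- The involution `σ = σ₁`, which changes the signs of `x₂` and `x₃`. -/
noncomputable def sigma : GLJ :=
  let s : J →L[ℝ] J := LinearMap.toContinuousLinearMap
    { toFun := fun X => h1 (X.1 0) (X.1 1) (X.1 2) (X.2 0) (-X.2 1) (-X.2 2)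
      map_add' := fun X Y => by
        apply Prod.ext <;> ext i : 1 <;> fin_cases i <;> simp [h1, add_comm]
      map_smul' := fun r X => by
        apply Prod.ext <;> ext i : 1 <;> fin_cases i <;> simp [h1] }
  have hs : s * s = 1 := by
    refine ContinuousLinearMap.ext fun X => ?_
    apply Prod.ext <;> ext i : 1 <;> fin_cases i <;> simp [s, h1]
  ⟨s, s, hs, hs⟩

/-- The maximal compact subgroup `K`: the elements of `F₄₍₋₂₀₎` fixed by `g ↦ σ g σ⁻¹`. -/
def K : Set GLJ := {g | g ∈ F4 ∧ sigma * g * sigma⁻¹ = g}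

/-! ### The Lie algebra elements -/

/-- The derivation `Ã₁¹(a)` of `𝒥¹`. -/
noncomputable def A1 (a : Octonion ℝ) : J →L[ℝ] J := LinearMap.toContinuousLinearMap
  { toFun := fun X => h1 0 (2 * inner ℝ a (X.2 0)) (-(2 * inner ℝ a (X.2 0)))
      (-((X.1 1 - X.1 2) • a)) (-star (X.2 2 * a)) (star (a * X.2 1))
    map_add' := fun X Y => by
      apply Prod.ext <;> ext i : 1 <;> fin_cases i <;>
        simp [h1, inner_add_right, mul_add, add_mul, add_smul, sub_smul] <;> first | ring | abel
    map_smul' := fun r X => by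
      apply Prod.ext <;> ext i : 1 <;> fin_cases i <;>
        simp [h1, inner_smul_right, smul_sub, mul_smul, sub_smul, smul_mul_assoc,
          mul_smul_comm] <;> ring }

/-- The derivation `Ã₂¹(a)` of `𝒥¹`. -/
noncomputable def A2 (a : Octonion ℝ) : J →L[ℝ] J := LinearMap.toContinuousLinearMap
  { toFun := fun X => h1 (2 * inner ℝ a (X.2 1)) 0 (-(2 * inner ℝ a (X.2 1)))
      (-star (a * X.2 2)) (-((X.1 2 - X.1 0) • a)) (-star (X.2 0 * a))
    map_add' := fun X Y => by
      apply Prod.ext <;> ext i : 1 <;> fin_cases i <;>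
        simp [h1, inner_add_right, mul_add, add_mul, add_smul, sub_smul] <;> first | ring | abel
    map_smul' := fun r X => by
      apply Prod.ext <;> ext i : 1 <;> fin_cases i <;>
        simp [h1, inner_smul_right, smul_sub, mul_smul, sub_smul, smul_mul_assoc,
          mul_smul_comm] <;> ring }

/-- The derivation `Ã₃¹(a)` of `𝒥¹`. -/
noncomputable def A3 (a : Octonion ℝ) : J →L[ℝ] J := LinearMap.toContinuousLinearMap
  { toFun := fun X => h1 (-(2 * inner ℝ a (X.2 2))) (2 * inner ℝ a (X.2 2)) 0
      (star (X.2 1 * a)) (star (a * X.2 0)) (-((X.1 0 - X.1 1) • a))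
    map_add' := fun X Y => by
      apply Prod.ext <;> ext i : 1 <;> fin_cases i <;>
        simp [h1, inner_add_right, mul_add, add_mul, add_smul, sub_smul] <;> first | ring | abel
    map_smul' := fun r X => by
      apply Prod.ext <;> ext i : 1 <;> fin_cases i <;>
        simp [h1, inner_smul_right, smul_sub, mul_smul, sub_smul, smul_mul_assoc,
          mul_smul_comm] <;> ring }

/-- The element `δ(p)` of `𝔡₄`, for `p ∈ Im 𝐎`: it annihilates the diagonal and acts by
`x₁ ↦ p x₁`, `x₂ ↦ x₂ p`, `x₃ ↦ -(p x₃ + x₃ p)`. It is the element `D` of `𝔡₄` for which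
`Ã₃¹(∓p) - D` has weight `±2` under `Ã₃¹(1)`. -/
noncomputable def delta (p : Octonion ℝ) : J →L[ℝ] J := LinearMap.toContinuousLinearMap
  { toFun := fun X => h1 0 0 0 (p * X.2 0) (X.2 1 * p) (-(p * X.2 2 + X.2 2 * p))
    map_add' := fun X Y => by
      apply Prod.ext <;> ext i : 1 <;> fin_cases i <;>
        simp [h1, mul_add, add_mul] <;> abel
    map_smul' := fun r X => by
      apply Prod.ext <;> ext i : 1 <;> fin_cases i <;>
        simp [h1, smul_add, smul_mul_assoc, mul_smul_comm] }

/-- The root vectors `𝒢₁(x)` of weight `α`, where `α(Ã₃¹(1)) = 1`. -/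
noncomputable def G1 (x : Octonion ℝ) : J →L[ℝ] J := A1 x + A2 (-star x)

/-- The root vectors `𝒢₋₁(x)` of weight `-α`. -/
noncomputable def Gm1 (x : Octonion ℝ) : J →L[ℝ] J := A1 x + A2 (star x)

/-- The root vectors `𝒢₂(p)`, `p ∈ Im 𝐎`, of weight `2α`. -/
noncomputable def G2 (p : Octonion ℝ) : J →L[ℝ] J := A3 (-p) - delta p

/-- The root vectors `𝒢₋₂(p)`, `p ∈ Im 𝐎`, of weight `-2α`. -/
noncomputable def Gm2 (p : Octonion ℝ) : J →L[ℝ] J := A3 p - delta p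

/-- The maximal abelian subspace `𝔞 = ℝ Ã₃¹(1)`. -/
noncomputable def aLie : Submodule ℝ (J →L[ℝ] J) := Submodule.span ℝ {A3 1}

/-- The one-parameter group `a_t = exp (t Ã₃¹(1))`. -/
noncomputable def a (t : ℝ) : GLJ := expGL (t • A3 1)

/-- The nilpotent group `N⁺ = exp 𝔫⁺`, where `𝔫⁺` consists of the elements `𝒢₁(x) + 𝒢₂(p)`. -/
def Nplus : Set GLJ := {n | ∃ x : Octonion ℝ, ∃ p ∈ Octonion.Im, n = expGL (G1 x + G2 p)}

/-! ### The Iwasawa component -/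

/-- `Y` is an `𝔞`-component of `g` in an Iwasawa decomposition `g = k (exp Y) n`. -/
def IsIwasawaComponent (g : GLJ) (Y : J →L[ℝ] J) : Prop :=
  Y ∈ aLie ∧ ∃ k ∈ K, ∃ n ∈ Nplus, g = k * expGL Y * n

open Classical in
/-- The Iwasawa projection `H`, with `g ∈ K (exp H(g)) N⁺` (and the value `0` where there is
no such decomposition). -/
noncomputable def H (g : GLJ) : J →L[ℝ] J :=
  if h : ∃ Y, IsIwasawaComponent g Y then h.choose else 0

end F4Iwasawa

namespace F4Iwasawa
open scoped Quaternion

set_option linter.unusedSimpArgs false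

/-! The Iwasawa component is read off from one linear form. Under `A3 1` the space `J` splits into
weight spaces of weights -2, -1, 0, 1, 2, and `horo` reads the component in the lowest one. Since
`G1` and `G2` raise weights, `horo` is fixed by `N⁺`, while `a s` multiplies it by `exp (-2 s)`. The
group `K` is the stabilizer of the idempotent `E1`, and `horo E1 = 1`. Hence `g = k (a s) n` gives
g⁻¹E₁ = n⁻¹ a₋ₛ E₁ and `horo` (g⁻¹E₁) = e²ˢ, so `s` is half the logarithm of `horo` (g⁻¹E₁). This is
uniqueness and the formula at once (`horo_inv_apply_E1_of_isIwasawaComponent`).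

Existence amounts to carrying v = g⁻¹E₁ back to `E1` by `A N⁺`. When `horo v > 0`, `N⁺` clears the
coordinates of `v` of weight -1 and the imaginary part of x₃, and `A` normalizes `horo` to 1. A
trace-one idempotent with these coordinates is `E1` (`eq_E1_of_jordan_self`), and an automorphism
fixing `E1` lies in `K`.

It remains to evaluate `horo` at z⁻¹ a₋ₜ E₁. The exponentials of `Gm1` and `Gm2` commute, and their
series end after degree 4 and degree 2 once `horo` is applied; this gives a polynomial in (x|x) and
(p|p) (`horo_inv_apply_a_apply_E1`). The formula for `z` is the case t = 0. -/

/-! ### Real coordinates of quaternions and octonions. -/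

theorem quaternion_coords :
    (∀ a b : ℍ[ℝ], (a + b).re = a.re + b.re) ∧
    (∀ a b : ℍ[ℝ], (a - b).re = a.re - b.re) ∧
    (∀ a : ℍ[ℝ], (-a).re = -a.re) ∧
    (∀ (r : ℝ) (a : ℍ[ℝ]), (r • a).re = r * a.re) ∧
    (∀ a : ℍ[ℝ], (star a).re = a.re) ∧
    (∀ a b : ℍ[ℝ], (a + b).imI = a.imI + b.imI) ∧
    (∀ a b : ℍ[ℝ], (a - b).imI = a.imI - b.imI) ∧
    (∀ a : ℍ[ℝ], (-a).imI = -a.imI) ∧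
    (∀ (r : ℝ) (a : ℍ[ℝ]), (r • a).imI = r * a.imI) ∧
    (∀ a : ℍ[ℝ], (star a).imI = -a.imI) ∧
    (∀ a b : ℍ[ℝ], (a + b).imJ = a.imJ + b.imJ) ∧
    (∀ a b : ℍ[ℝ], (a - b).imJ = a.imJ - b.imJ) ∧
    (∀ a : ℍ[ℝ], (-a).imJ = -a.imJ) ∧
    (∀ (r : ℝ) (a : ℍ[ℝ]), (r • a).imJ = r * a.imJ) ∧
    (∀ a : ℍ[ℝ], (star a).imJ = -a.imJ) ∧
    (∀ a b : ℍ[ℝ], (a + b).imK = a.imK + b.imK) ∧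
    (∀ a b : ℍ[ℝ], (a - b).imK = a.imK - b.imK) ∧
    (∀ a : ℍ[ℝ], (-a).imK = -a.imK) ∧
    (∀ (r : ℝ) (a : ℍ[ℝ]), (r • a).imK = r * a.imK) ∧
    (∀ a : ℍ[ℝ], (star a).imK = -a.imK) ∧
    (∀ a b : ℍ[ℝ], (a * b).re =
      a.re * b.re - a.imI * b.imI - a.imJ * b.imJ - a.imK * b.imK) ∧
    (∀ a b : ℍ[ℝ], (a * b).imI =
      a.re * b.imI + a.imI * b.re + a.imJ * b.imK - a.imK * b.imJ) ∧
    (∀ a b : ℍ[ℝ], (a * b).imJ =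
      a.re * b.imJ - a.imI * b.imK + a.imJ * b.re + a.imK * b.imI) ∧
    (∀ a b : ℍ[ℝ], (a * b).imK =
      a.re * b.imK + a.imI * b.imJ - a.imJ * b.imI + a.imK * b.re) :=
  ⟨Quaternion.re_add,
    Quaternion.re_sub,
    Quaternion.re_neg,
    fun _ _ => rfl,
    Quaternion.re_star,
    Quaternion.imI_add,
    Quaternion.imI_sub,
    Quaternion.imI_neg,
    fun _ _ => rfl,
    Quaternion.imI_star,
    Quaternion.imJ_add,
    Quaternion.imJ_sub,
    Quaternion.imJ_neg,
    fun _ _ => rfl,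
    Quaternion.imJ_star,
    Quaternion.imK_add,
    Quaternion.imK_sub,
    Quaternion.imK_neg,
    fun _ _ => rfl,
    Quaternion.imK_star,
    Quaternion.re_mul,
    Quaternion.imI_mul,
    Quaternion.imJ_mul,
    Quaternion.imK_mul⟩

theorem Octonion.coords :
    (∀ x y : Octonion ℝ, (x + y).1 = x.1 + y.1) ∧
    (∀ x y : Octonion ℝ, (x + y).2 = x.2 + y.2) ∧
    (∀ x y : Octonion ℝ, (x - y).1 = x.1 - y.1) ∧
    (∀ x y : Octonion ℝ, (x - y).2 = x.2 - y.2) ∧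
    (∀ x : Octonion ℝ, (-x).1 = -x.1) ∧
    (∀ (r : ℝ) (x : Octonion ℝ), (r • x).1 = r • x.1) ∧
    (∀ x : Octonion ℝ, (-x).2 = -x.2) ∧
    (∀ (r : ℝ) (x : Octonion ℝ), (r • x).2 = r • x.2) ∧
    (∀ x y : Octonion ℝ, (x * y).1 = x.1 * y.1 - star y.2 * x.2) ∧
    (∀ x y : Octonion ℝ, (x * y).2 = y.2 * x.1 + x.2 * star y.1) ∧
    (∀ x : Octonion ℝ, (star x).1 = star x.1) ∧
    (∀ x : Octonion ℝ, (star x).2 = -x.2) :=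
  ⟨Octonion.add_fst, Octonion.add_snd, Octonion.sub_fst, Octonion.sub_snd, Octonion.neg_fst,
  Octonion.smul_fst, Octonion.neg_snd, Octonion.smul_snd, Octonion.mul_fst, Octonion.mul_snd,
  Octonion.star_fst, Octonion.star_snd⟩

theorem Octonion.coords_one :
    (1 : Octonion ℝ).1 = 1 ∧ (1 : Octonion ℝ).2 = 0 ∧ (1 : ℍ[ℝ]).re = 1 ∧
    (1 : ℍ[ℝ]).imI = 0 ∧ (1 : ℍ[ℝ]).imJ = 0 ∧ (1 : ℍ[ℝ]).imK = 0 :=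
  ⟨rfl, rfl, rfl, rfl, rfl, rfl⟩

theorem Octonion.coords_zero :
    (0 : Octonion ℝ).1 = 0 ∧ (0 : Octonion ℝ).2 = 0 ∧ (0 : ℍ[ℝ]).re = 0 ∧
    (0 : ℍ[ℝ]).imI = 0 ∧ (0 : ℍ[ℝ]).imJ = 0 ∧ (0 : ℍ[ℝ]).imK = 0 :=
  ⟨rfl, rfl, rfl, rfl, rfl, rfl⟩

/-! ### Composition and alternativity of the octonions. -/

namespace Octonion

/-- Polarization of x̄(xz) = (x|x)z. With its mirror image `mul_mul_star_add`, it is what makes the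
`A1`, `A2`, `A3` derivations. -/
theorem star_mul_mul_add (x y z : Octonion ℝ) :
    star x * (y * z) + star y * (x * z) = (2 * inner ℝ x y) • z := by
  simp only [inner_def]
  apply Octonion.ext <;> apply Quaternion.ext <;>
    simp only [coords, quaternion_coords] <;> ring

theorem associator_swap (x y z : Octonion ℝ) :
    x * y * z - x * (y * z) = -(y * x * z - y * (x * z)) := by
  apply Octonion.ext <;> apply Quaternion.ext <;>
    simp only [coords, quaternion_coords] <;> ring

theorem associator_rotate (x y z : Octonion ℝ) :
    x * y * z - x * (y * z) = y * z * x - y * (z * x) := by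
  apply Octonion.ext <;> apply Quaternion.ext <;>
    simp only [coords, quaternion_coords] <;> ring

theorem associator_swap_right (x y z : Octonion ℝ) :
    x * y * z - x * (y * z) = -(x * z * y - x * (z * y)) := by
  rw [associator_rotate x y z, associator_rotate x z y, associator_swap y z x]

theorem inner_star_star (x y : Octonion ℝ) : inner ℝ (star x) (star y) = (inner ℝ x y : ℝ) := by
  simp [inner_def]

theorem mul_mul_star_add (x y z : Octonion ℝ) :
    z * y * star x + z * x * star y = (2 * inner ℝ x y) • z := by
  have h := congrArg star (star_mul_mul_add (star x) (star y) (star z))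
  simpa only [star_add', star_mul', star_smul', star_star', inner_star_star] using h

theorem star_of_mem_Im {p : Octonion ℝ} (hp : p ∈ Im) : star p = -p := by
  have hp' : p.1.re = 0 := hp
  apply Octonion.ext <;> apply Quaternion.ext <;> simp [hp']

theorem star_neg' (x : Octonion ℝ) : star (-x) = -star x := by
  apply Octonion.ext <;> simp

theorem star_zero' : star (0 : Octonion ℝ) = 0 := by
  apply Octonion.ext <;> simp

end Octonion

/-! ### The generators are derivations. -/

theorem A1_apply (a : Octonion ℝ) (X : J) : A1 a X =
    h1 0 (2 * inner ℝ a (X.2 0)) (-(2 * inner ℝ a (X.2 0)))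
      (-((X.1 1 - X.1 2) • a)) (-star (X.2 2 * a)) (star (a * X.2 1)) := rfl

theorem A2_apply (a : Octonion ℝ) (X : J) : A2 a X =
    h1 (2 * inner ℝ a (X.2 1)) 0 (-(2 * inner ℝ a (X.2 1)))
      (-star (a * X.2 2)) (-((X.1 2 - X.1 0) • a)) (-star (X.2 0 * a)) := rfl

theorem A3_apply (a : Octonion ℝ) (X : J) : A3 a X =
    h1 (-(2 * inner ℝ a (X.2 2))) (2 * inner ℝ a (X.2 2)) 0
      (star (X.2 1 * a)) (star (a * X.2 0)) (-((X.1 0 - X.1 1) • a)) := rfl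

theorem delta_apply (p : Octonion ℝ) (X : J) : delta p X =
    h1 0 0 0 (p * X.2 0) (X.2 1 * p) (-(p * X.2 2 + X.2 2 * p)) := rfl

theorem J_ext {X Y : J} (h₁ : X.1 0 = Y.1 0) (h₂ : X.1 1 = Y.1 1) (h₃ : X.1 2 = Y.1 2)
    (k₁ : X.2 0 = Y.2 0) (k₂ : X.2 1 = Y.2 1) (k₃ : X.2 2 = Y.2 2) : X = Y := by
  apply Prod.ext <;> ext i : 1 <;> fin_cases i <;> assumption

@[simp] theorem h1_coords (ξ₁ ξ₂ ξ₃ : ℝ) (x₁ x₂ x₃ : Octonion ℝ) :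
    (h1 ξ₁ ξ₂ ξ₃ x₁ x₂ x₃).1 0 = ξ₁ ∧ (h1 ξ₁ ξ₂ ξ₃ x₁ x₂ x₃).1 1 = ξ₂ ∧
    (h1 ξ₁ ξ₂ ξ₃ x₁ x₂ x₃).1 2 = ξ₃ ∧ (h1 ξ₁ ξ₂ ξ₃ x₁ x₂ x₃).2 0 = x₁ ∧
    (h1 ξ₁ ξ₂ ξ₃ x₁ x₂ x₃).2 1 = x₂ ∧ (h1 ξ₁ ξ₂ ξ₃ x₁ x₂ x₃).2 2 = x₃ :=
  ⟨rfl, rfl, rfl, rfl, rfl, rfl⟩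

theorem h1_add (ξ₁ ξ₂ ξ₃ η₁ η₂ η₃ : ℝ) (x₁ x₂ x₃ y₁ y₂ y₃ : Octonion ℝ) :
    h1 ξ₁ ξ₂ ξ₃ x₁ x₂ x₃ + h1 η₁ η₂ η₃ y₁ y₂ y₃ =
      h1 (ξ₁ + η₁) (ξ₂ + η₂) (ξ₃ + η₃) (x₁ + y₁) (x₂ + y₂) (x₃ + y₃) := by
  apply J_ext <;> rfl

theorem h1_sub (ξ₁ ξ₂ ξ₃ η₁ η₂ η₃ : ℝ) (x₁ x₂ x₃ y₁ y₂ y₃ : Octonion ℝ) :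
    h1 ξ₁ ξ₂ ξ₃ x₁ x₂ x₃ - h1 η₁ η₂ η₃ y₁ y₂ y₃ =
      h1 (ξ₁ - η₁) (ξ₂ - η₂) (ξ₃ - η₃) (x₁ - y₁) (x₂ - y₂) (x₃ - y₃) := by
  apply J_ext <;> rfl

/-- `D` is a derivation of the Jordan product of `𝒥¹`. -/
def IsDerivation (D : J →L[ℝ] J) : Prop :=
  ∀ X Y : J, D (jordan X Y) = jordan (D X) Y + jordan X (D Y)

/-- The diagonal entries compare inner products of octonion products and are checked in coordinates.
Each off-diagonal entry is a combination of two polarized composition identities. The same pattern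
serves `A2` and `A3`. -/
theorem isDerivation_A1 (a : Octonion ℝ) : IsDerivation (A1 a) := by
  intro X Y
  rcases X with ⟨ξ, x⟩
  rcases Y with ⟨η, y⟩
  simp only [jordan, A1_apply, h1_add]
  apply J_ext <;> simp only [h1_coords,
    Octonion.star_mul', Octonion.star_add', Octonion.star_sub', Octonion.star_smul',
    Octonion.star_star', Octonion.star_neg', mul_add, add_mul, mul_sub, sub_mul, smul_mul_assoc,
    mul_smul_comm, neg_mul,
    mul_neg]
  case h₁ | h₂ | h₃ =>
    simp only [Octonion.inner_def, Octonion.coords, quaternion_coords]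
    ring
  case k₁ =>
    linear_combination (norm := module) (-1 / 2 : ℝ) • Octonion.star_mul_mul_add (x 2) (y 2) a
      + (1 / 2 : ℝ) • Octonion.mul_mul_star_add (x 1) (y 1) a
  case k₂ =>
    linear_combination (norm := module) (-1 / 2 : ℝ) • Octonion.star_mul_mul_add a (x 0) (y 1)
      + (-1 / 2 : ℝ) • Octonion.star_mul_mul_add a (y 0) (x 1)
  case k₃ =>
    linear_combination (norm := module) (1 / 2 : ℝ) • Octonion.mul_mul_star_add a (x 0) (y 2)
      + (1 / 2 : ℝ) • Octonion.mul_mul_star_add a (y 0) (x 2)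

theorem isDerivation_A2 (a : Octonion ℝ) : IsDerivation (A2 a) := by
  intro X Y
  rcases X with ⟨ξ, x⟩
  rcases Y with ⟨η, y⟩
  simp only [jordan, A2_apply, h1_add]
  apply J_ext <;> simp only [h1_coords,
    Octonion.star_mul', Octonion.star_add', Octonion.star_sub', Octonion.star_smul',
    Octonion.star_star', Octonion.star_neg', mul_add, add_mul, mul_sub, sub_mul, smul_mul_assoc,
    mul_smul_comm, neg_mul,
    mul_neg]
  case h₁ | h₂ | h₃ =>
    simp only [Octonion.inner_def, Octonion.coords, quaternion_coords]
    ring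
  case k₁ =>
    linear_combination (norm := module) (-1 / 2 : ℝ) • Octonion.mul_mul_star_add a (y 1) (x 0)
      + (-1 / 2 : ℝ) • Octonion.mul_mul_star_add a (x 1) (y 0)
  case k₂ =>
    linear_combination (norm := module) (1 / 2 : ℝ) • Octonion.star_mul_mul_add (x 0) (y 0) a
      + (1 / 2 : ℝ) • Octonion.mul_mul_star_add (x 2) (y 2) a
  case k₃ =>
    linear_combination (norm := module) (1 / 2 : ℝ) • Octonion.star_mul_mul_add a (x 1) (y 2)
      + (1 / 2 : ℝ) • Octonion.star_mul_mul_add a (y 1) (x 2)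

theorem isDerivation_A3 (a : Octonion ℝ) : IsDerivation (A3 a) := by
  intro X Y
  rcases X with ⟨ξ, x⟩
  rcases Y with ⟨η, y⟩
  simp only [jordan, A3_apply, h1_add]
  apply J_ext <;> simp only [h1_coords,
    Octonion.star_mul', Octonion.star_add', Octonion.star_sub', Octonion.star_smul',
    Octonion.star_star', Octonion.star_neg', mul_add, add_mul, mul_sub, sub_mul, smul_mul_assoc,
    mul_smul_comm, neg_mul,
    mul_neg]
  case h₁ | h₂ | h₃ =>
    simp only [Octonion.inner_def, Octonion.coords, quaternion_coords]
    ring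
  case k₁ =>
    linear_combination (norm := module) (1 / 2 : ℝ) • Octonion.star_mul_mul_add a (x 2) (y 0)
      + (1 / 2 : ℝ) • Octonion.star_mul_mul_add a (y 2) (x 0)
  case k₂ =>
    linear_combination (norm := module) (-1 / 2 : ℝ) • Octonion.mul_mul_star_add a (y 2) (x 1)
      + (-1 / 2 : ℝ) • Octonion.mul_mul_star_add a (x 2) (y 1)
  case k₃ =>
    linear_combination (norm := module) (-1 / 2 : ℝ) • Octonion.star_mul_mul_add (x 1) (y 1) a
      + (-1 / 2 : ℝ) • Octonion.mul_mul_star_add (x 0) (y 0) a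

/-- Infinitesimal triality: left, right and two-sided multiplication by `p` are compatible because
the associator is alternating. The diagonal entries hold because multiplication by an imaginary
octonion is skew for the inner product. -/
theorem isDerivation_delta {p : Octonion ℝ} (hp : p ∈ Octonion.Im) : IsDerivation (delta p) := by
  have hp₀ : p.1.re = 0 := hp
  intro X Y
  rcases X with ⟨ξ, x⟩
  rcases Y with ⟨η, y⟩
  simp only [jordan, delta_apply, h1_add]
  apply J_ext <;> simp only [h1_coords,
    Octonion.star_mul', Octonion.star_add', Octonion.star_sub', Octonion.star_smul',
    Octonion.star_star', Octonion.star_neg', mul_add, add_mul, mul_sub, sub_mul, smul_mul_assoc,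
    mul_smul_comm, neg_mul,
    mul_neg, Octonion.star_of_mem_Im hp]
  case h₁ | h₂ | h₃ =>
    simp only [Octonion.inner_def, Octonion.coords, quaternion_coords, hp₀]
    ring
  case k₁ =>
    linear_combination (norm := module)
      (1 / 2 : ℝ) • Octonion.associator_swap p (star (y 2)) (star (x 1))
      + (1 / 2 : ℝ) • Octonion.associator_swap p (star (x 2)) (star (y 1))
  case k₂ =>
    linear_combination (norm := module)
      (1 / 2 : ℝ) • Octonion.associator_swap_right (star (y 0)) (star (x 2)) p
      + (1 / 2 : ℝ) • Octonion.associator_swap_right (star (x 0)) (star (y 2)) p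
  case k₃ =>
    linear_combination (norm := module)
      (1 / 2 : ℝ) • Octonion.associator_rotate p (star (y 1)) (star (x 0))
      + (1 / 2 : ℝ) • Octonion.associator_rotate p (star (x 1)) (star (y 0))

/-! ### Exponentials of derivations, seen through linear forms. -/

theorem exp_zero_clm {E : Type*} [NormedAddCommGroup E] [NormedSpace ℝ E] :
    NormedSpace.exp (0 : E →L[ℝ] E) = 1 :=
  NormedSpace.exp_zero

section ContinuousLinearMap

variable {E : Type*} [NormedAddCommGroup E] [NormedSpace ℝ E] [CompleteSpace E]

theorem exp_add_of_commute_clm {D D' : E →L[ℝ] E} (h : Commute D D') :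
    NormedSpace.exp (D + D') = NormedSpace.exp D * NormedSpace.exp D' := by
  let : NormedAlgebra ℚ (E →L[ℝ] E) := .restrictScalars ℚ ℝ (E →L[ℝ] E)
  exact NormedSpace.exp_add_of_commute h

theorem exp_neg_apply_exp_apply (D : E →L[ℝ] E) (X : E) :
    NormedSpace.exp (-D) (NormedSpace.exp D X) = X := by
  have h := exp_add_of_commute_clm (Commute.refl D).neg_left
  rw [neg_add_cancel, exp_zero_clm] at h
  exact (congrArg (fun f : E →L[ℝ] E => f X) h).symm

theorem exp_apply_exp_neg_apply (D : E →L[ℝ] E) (X : E) :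
    NormedSpace.exp D (NormedSpace.exp (-D) X) = X := by
  simpa using exp_neg_apply_exp_apply (-D) X

/-- The exponential of a derivation of a bilinear map is an automorphism of it. -/
theorem exp_map_bilin {B : E →L[ℝ] E →L[ℝ] E} {D : E →L[ℝ] E}
    (h : ∀ X Y, D (B X Y) = B (D X) Y + B X (D Y)) (X Y : E) :
    NormedSpace.exp D (B X Y) = B (NormedSpace.exp D X) (NormedSpace.exp D Y) := by
  have hd : ∀ (Z : E) (s : ℝ), HasDerivAt (fun s : ℝ => NormedSpace.exp (s • D) Z)
      (D (NormedSpace.exp (s • D) Z)) s := fun Z s => by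
    simpa using (hasDerivAt_exp_smul_const' (𝕂 := ℝ) D s).clm_apply (hasDerivAt_const s Z)
  -- The product transported along the flow and pulled back at time `s`. The derivation rule makes
  -- its derivative vanish, so its values at 0 and 1 agree.
  let F : ℝ → E := fun s =>
    NormedSpace.exp (s • -D) (B (NormedSpace.exp (s • D) X) (NormedSpace.exp (s • D) Y))
  have hF : ∀ s, HasDerivAt F 0 s := by
    intro s
    have h1 := (hasDerivAt_exp_smul_const (𝕂 := ℝ) (-D) s)
    have h2 := (B.hasFDerivAt.comp_hasDerivAt s (hd X s)).clm_apply (hd Y s)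
    convert! h1.clm_apply h2 using 1
    simp [h]
  have hc : F 1 = F 0 := is_const_of_deriv_eq_zero (fun s => (hF s).differentiableAt)
    (fun s => (hF s).deriv) 1 0
  simp only [F, one_smul, zero_smul, exp_zero_clm, one_apply_eq_self] at hc
  rw [← hc, exp_apply_exp_neg_apply]

end ContinuousLinearMap

open scoped Nat in
theorem hasSum_map_expGL {E : Type*} [NormedAddCommGroup E] [NormedSpace ℝ E]
    (Φ : J →ₗ[ℝ] E) (D : J →L[ℝ] J) (X : J) :
    HasSum (fun n : ℕ => ((n ! : ℝ)⁻¹) • Φ ((D ^ n) X)) (Φ ((expGL D).1 X)) := by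
  have h := NormedSpace.exp_series_hasSum_exp' (𝕂 := ℝ) D
  have h' := h.mapL (LinearMap.toContinuousLinearMap Φ ∘L ContinuousLinearMap.apply ℝ J X)
  convert! h' using 1
  ext n
  simp

/-- `Φ` is an eigenvector of precomposition with `D`, so the exponential series collapses to the
scalar one. -/
theorem map_expGL_of_weight {E : Type*} [NormedAddCommGroup E] [NormedSpace ℝ E]
    {Φ : J →ₗ[ℝ] E} {D : J →L[ℝ] J} {c : ℝ} (h : ∀ X, Φ (D X) = c • Φ X) (X : J) :
    Φ ((expGL D).1 X) = Real.exp c • Φ X := by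
  have hpow : ∀ n : ℕ, Φ ((D ^ n) X) = c ^ n • Φ X := by
    intro n
    induction n with
    | zero => simp
    | succ n ih => rw [pow_succ', mul_apply_eq_comp, h, ih, smul_smul, pow_succ']
  refine (hasSum_map_expGL Φ D X).unique ?_
  have hs := (NormedSpace.exp_series_hasSum_exp' (𝕂 := ℝ) c).smul_const (Φ X)
  rw [← Real.exp_eq_exp_ℝ] at hs
  simpa only [hpow, smul_eq_mul, mul_smul] using hs

-- Only `Φ` composed with `D ^ N` has to vanish, so the length of the sum is adapted to the
-- coordinate `Φ`. The later terms vanish because `D ^ (N + m)` begins with `D ^ N` on the left.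
open scoped Nat in
theorem map_expGL_eq_sum {E : Type*} [NormedAddCommGroup E] [NormedSpace ℝ E]
    {Φ : J →ₗ[ℝ] E} {D : J →L[ℝ] J} (N : ℕ) (h : ∀ X, Φ ((D ^ N) X) = 0) (X : J) :
    Φ ((expGL D).1 X) = ∑ n ∈ Finset.range N, ((n ! : ℝ)⁻¹) • Φ ((D ^ n) X) := by
  refine (hasSum_map_expGL Φ D X).unique (hasSum_sum_of_ne_finset_zero ?_)
  intro n hn
  obtain ⟨m, rfl⟩ := Nat.exists_eq_add_of_le (not_lt.1 fun hlt => hn (Finset.mem_range.2 hlt))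
  rw [pow_add, mul_apply_eq_comp, h, smul_zero]

theorem map_expGL_of_map_eq_zero {E : Type*} [NormedAddCommGroup E] [NormedSpace ℝ E]
    {Φ : J →ₗ[ℝ] E} {D : J →L[ℝ] J} (h : ∀ X, Φ (D X) = 0) (X : J) :
    Φ ((expGL D).1 X) = Φ X := by
  simpa using map_expGL_eq_sum 1 (by simpa using h) X

theorem map_expGL_of_map_map_eq_zero {E : Type*} [NormedAddCommGroup E] [NormedSpace ℝ E]
    {Φ : J →ₗ[ℝ] E} {D : J →L[ℝ] J} (h : ∀ X, Φ (D (D X)) = 0) (X : J) :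
    Φ ((expGL D).1 X) = Φ X + Φ (D X) := by
  simpa [Finset.sum_range_succ] using map_expGL_eq_sum 2 (by simpa [pow_two] using h) X

theorem expGL_add {D D' : J →L[ℝ] J} (h : Commute D D') :
    expGL (D + D') = expGL D * expGL D' :=
  Units.ext (exp_add_of_commute_clm (E := J) h)

theorem expGL_neg (D : J →L[ℝ] J) : expGL (-D) = (expGL D)⁻¹ := by
  rw [eq_inv_iff_mul_eq_one, ← expGL_add (Commute.refl D).neg_left, neg_add_cancel]
  exact Units.ext (exp_zero_clm (E := J))

/-- The Jordan product as a bilinear map. -/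
noncomputable def jordanₗ : J →ₗ[ℝ] J →ₗ[ℝ] J :=
  LinearMap.mk₂ ℝ jordan
    (fun X Y Z => by
      apply J_ext <;> simp only [jordan, h1_add, h1_coords,
        Prod.fst_add, Prod.snd_add, Pi.add_apply, inner_add_left, mul_add, add_mul,
        Octonion.star_add'] <;>
        first | ring1 | module)
    (fun c X Y => by
      apply J_ext <;> simp only [jordan, h1_coords, Prod.smul_fst, Prod.smul_snd, Pi.smul_apply,
        smul_eq_mul, inner_smul_left, RCLike.conj_to_real, mul_smul_comm, smul_mul_assoc,
        Octonion.star_smul'] <;>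
        first | ring1 | module)
    (fun X Y Z => by
      apply J_ext <;> simp only [jordan, h1_add, h1_coords,
        Prod.fst_add, Prod.snd_add, Pi.add_apply, inner_add_right, mul_add, add_mul,
        Octonion.star_add'] <;>
        first | ring1 | module)
    (fun c X Y => by
      apply J_ext <;> simp only [jordan, h1_coords, Prod.smul_fst, Prod.smul_snd, Pi.smul_apply,
        smul_eq_mul, inner_smul_right, RCLike.conj_to_real, mul_smul_comm, smul_mul_assoc,
        Octonion.star_smul'] <;>
        first | ring1 | module)

namespace IsDerivation

variable {D D' : J →L[ℝ] J}

theorem add (h : IsDerivation D) (h' : IsDerivation D') : IsDerivation (D + D') := by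
  intro X Y
  change D (jordan X Y) + D' (jordan X Y) = jordanₗ (D X + D' X) Y + jordanₗ X (D Y + D' Y)
  rw [h, h', map_add, map_add, LinearMap.add_apply]
  exact add_add_add_comm _ _ _ _

theorem smul (c : ℝ) (h : IsDerivation D) : IsDerivation (c • D) := by
  intro X Y
  change c • D (jordan X Y) = jordanₗ (c • D X) Y + jordanₗ X (c • D Y)
  rw [h, map_smul, map_smul, LinearMap.smul_apply, smul_add]
  rfl

theorem neg (h : IsDerivation D) : IsDerivation (-D) := by
  rw [← neg_one_smul ℝ]
  exact h.smul (-1)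

theorem sub (h : IsDerivation D) (h' : IsDerivation D') : IsDerivation (D - D') := by
  simpa [sub_eq_add_neg] using h.add h'.neg

/-- The exponential of a derivation is an automorphism. -/
theorem expGL_mem_F4 (h : IsDerivation D) : expGL D ∈ F4 := by
  intro X Y
  exact exp_map_bilin (E := J) (B := jordanₗ.toContinuousBilinearMap) h X Y

end IsDerivation

/-! ### Root vectors in coordinates, and their commutation. -/

theorem G1_apply (y : Octonion ℝ) (X : J) : G1 y X =
    h1 (-(2 * inner ℝ (star y) (X.2 1))) (2 * inner ℝ y (X.2 0))
      (2 * inner ℝ (star y) (X.2 1) - 2 * inner ℝ y (X.2 0))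
      (star (X.2 2) * y - (X.1 1 - X.1 2) • y)
      ((X.1 2 - X.1 0) • star y - star y * star (X.2 2))
      (star (X.2 1) * star y + y * star (X.2 0)) := by
  change A1 y X + A2 (-star y) X = _
  rw [A1_apply, A2_apply, h1_add]
  apply J_ext <;> simp only [h1_coords, inner_neg_left, Octonion.star_mul', Octonion.star_neg',
    Octonion.star_star', neg_mul, mul_neg, smul_neg] <;> first | ring1 | abel

theorem Gm1_apply (y : Octonion ℝ) (X : J) : Gm1 y X =
    h1 (2 * inner ℝ (star y) (X.2 1)) (2 * inner ℝ y (X.2 0))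
      (-(2 * inner ℝ (star y) (X.2 1)) - 2 * inner ℝ y (X.2 0))
      (-(star (X.2 2) * y) - (X.1 1 - X.1 2) • y)
      (-((X.1 2 - X.1 0) • star y) - star y * star (X.2 2))
      (star (X.2 1) * star y - y * star (X.2 0)) := by
  change A1 y X + A2 (star y) X = _
  rw [A1_apply, A2_apply, h1_add]
  apply J_ext <;> simp only [h1_coords, Octonion.star_mul',
    Octonion.star_star'] <;> first | ring1 | abel

theorem G2_apply {q : Octonion ℝ} (hq : q ∈ Octonion.Im) (X : J) : G2 q X =
    h1 (2 * inner ℝ q (X.2 2)) (-(2 * inner ℝ q (X.2 2))) 0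
      (q * star (X.2 1) - q * X.2 0) (star (X.2 0) * q - X.2 1 * q)
      ((X.1 0 - X.1 1) • q + (q * X.2 2 + X.2 2 * q)) := by
  change A3 (-q) X - delta q X = _
  rw [A3_apply, delta_apply, h1_sub]
  apply J_ext <;> simp only [h1_coords, inner_neg_left, Octonion.star_mul', Octonion.star_neg',
    Octonion.star_of_mem_Im hq, neg_mul, mul_neg, smul_neg, neg_neg] <;> first | ring1 | abel

theorem Gm2_apply {q : Octonion ℝ} (hq : q ∈ Octonion.Im) (X : J) : Gm2 q X =
    h1 (-(2 * inner ℝ q (X.2 2))) (2 * inner ℝ q (X.2 2)) 0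
      (-(q * star (X.2 1)) - q * X.2 0) (-(star (X.2 0) * q) - X.2 1 * q)
      ((q * X.2 2 + X.2 2 * q) - (X.1 0 - X.1 1) • q) := by
  change A3 q X - delta q X = _
  rw [A3_apply, delta_apply, h1_sub]
  apply J_ext <;> simp only [h1_coords, Octonion.star_mul',
    Octonion.star_of_mem_Im hq, neg_mul, mul_neg, smul_neg, neg_neg] <;> first | ring1 | abel

-- The bracket would have weight 3α, which is not a root. The vanishing is verified entry by entry.
set_option maxHeartbeats 1000000 in
theorem commute_G1_G2 (y : Octonion ℝ) {q : Octonion ℝ} (hq : q ∈ Octonion.Im) :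
    Commute (G1 y) (G2 q) := by
  have hq₀ : q.1.re = 0 := hq
  refine ContinuousLinearMap.ext fun X => ?_
  rcases X with ⟨ξ, x⟩
  rw [mul_apply_eq_comp, mul_apply_eq_comp, G1_apply, G1_apply, G2_apply hq, G2_apply hq]
  apply J_ext <;> simp only [h1_coords, Octonion.star_mul', Octonion.star_add', Octonion.star_sub',
    Octonion.star_smul', Octonion.star_star', Octonion.star_neg', Octonion.star_of_mem_Im hq]
  case h₁ | h₂ | h₃ =>
    simp only [Octonion.inner_def, Octonion.coords, quaternion_coords, hq₀]
    ring1
  all_goals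
    simp only [Octonion.inner_def]
    apply Octonion.ext <;> apply Quaternion.ext <;> simp only [Octonion.coords, quaternion_coords,
      hq₀] <;> ring1

set_option maxHeartbeats 1000000 in
theorem commute_Gm1_Gm2 (y : Octonion ℝ) {q : Octonion ℝ} (hq : q ∈ Octonion.Im) :
    Commute (Gm1 y) (Gm2 q) := by
  have hq₀ : q.1.re = 0 := hq
  refine ContinuousLinearMap.ext fun X => ?_
  rcases X with ⟨ξ, x⟩
  rw [mul_apply_eq_comp, mul_apply_eq_comp, Gm1_apply, Gm1_apply, Gm2_apply hq, Gm2_apply hq]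
  apply J_ext <;> simp only [h1_coords, Octonion.star_mul', Octonion.star_add', Octonion.star_sub',
    Octonion.star_smul', Octonion.star_star', Octonion.star_neg', Octonion.star_of_mem_Im hq]
  case h₁ | h₂ | h₃ =>
    simp only [Octonion.inner_def, Octonion.coords, quaternion_coords, hq₀]
    ring1
  all_goals
    simp only [Octonion.inner_def]
    apply Octonion.ext <;> apply Quaternion.ext <;> simp only [Octonion.coords, quaternion_coords,
      hq₀] <;> ring1

/-! ### Weight coordinates on `𝒥¹` and the infinitesimal action on them. -/

/-- The linear form `X ↦ ξ₁ - ξ₂ + 2 Re x₃` on `𝒥¹`; it is fixed by `N⁺` and has weight `-2`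
under `Ã₃¹(1)`. -/
noncomputable def horo : J →ₗ[ℝ] ℝ where
  toFun X := X.1 0 - X.1 1 + 2 * inner ℝ 1 (X.2 2)
  map_add' X Y := by simp [inner_add_right]; ring
  map_smul' r X := by simp [inner_smul_right]; ring

/-- The linear form `X ↦ ξ₁ - ξ₂ - 2 Re x₃` on `𝒥¹`, of weight `2` under `Ã₃¹(1)`. -/
noncomputable def opHoro : J →ₗ[ℝ] ℝ where
  toFun X := X.1 0 - X.1 1 - 2 * inner ℝ 1 (X.2 2)
  map_add' X Y := by simp [inner_add_right]; ring
  map_smul' r X := by simp [inner_smul_right]; ring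

/-- The linear form `X ↦ ξ₁ + ξ₂ - 2 ξ₃` on `𝒥¹`, of weight `0` under `Ã₃¹(1)`. -/
noncomputable def diagForm : J →ₗ[ℝ] ℝ where
  toFun X := X.1 0 + X.1 1 - 2 * X.1 2
  map_add' X Y := by simp; ring
  map_smul' r X := by simp; ring

/-- The trace of an element of `𝒥¹`. -/
noncomputable def traceForm : J →ₗ[ℝ] ℝ where
  toFun X := X.1 0 + X.1 1 + X.1 2
  map_add' X Y := by simp; ring
  map_smul' r X := by simp; ring

/-- The coordinate `X ↦ x₁ - x̄₂` of `𝒥¹`, of weight `-1` under `Ã₃¹(1)`. -/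
noncomputable def lowCoord : J →ₗ[ℝ] Octonion ℝ where
  toFun X := X.2 0 - star (X.2 1)
  map_add' X Y := by simp; abel
  map_smul' r X := by simp [smul_sub]

/-- The coordinate `X ↦ x₁ + x̄₂` of `𝒥¹`, of weight `1` under `Ã₃¹(1)`. -/
noncomputable def highCoord : J →ₗ[ℝ] Octonion ℝ where
  toFun X := X.2 0 + star (X.2 1)
  map_add' X Y := by simp; abel
  map_smul' r X := by simp [smul_add]

/-- The vector part `X ↦ Im x₃`, of weight `0` under `Ã₃¹(1)`. -/
noncomputable def imCoord : J →ₗ[ℝ] Octonion ℝ where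
  toFun X := X.2 2 - (inner ℝ 1 (X.2 2) : ℝ) • (1 : Octonion ℝ)
  map_add' X Y := by simp only [Prod.snd_add, Pi.add_apply, inner_add_right]; module
  map_smul' r X := by
    simp only [Prod.smul_snd, Pi.smul_apply, inner_smul_right, RingHom.id_apply]; module

theorem horo_apply (X : J) : horo X = X.1 0 - X.1 1 + 2 * inner ℝ 1 (X.2 2) := rfl
theorem opHoro_apply (X : J) : opHoro X = X.1 0 - X.1 1 - 2 * inner ℝ 1 (X.2 2) := rfl
theorem diagForm_apply (X : J) : diagForm X = X.1 0 + X.1 1 - 2 * X.1 2 := rfl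
theorem traceForm_apply (X : J) : traceForm X = X.1 0 + X.1 1 + X.1 2 := rfl
theorem lowCoord_apply (X : J) : lowCoord X = X.2 0 - star (X.2 1) := rfl
theorem highCoord_apply (X : J) : highCoord X = X.2 0 + star (X.2 1) := rfl
theorem imCoord_apply (X : J) :
    imCoord X = X.2 2 - (inner ℝ 1 (X.2 2) : ℝ) • (1 : Octonion ℝ) := rfl

/-- `G1 y` raises weights by one, so nothing reaches the lowest weight space, which `horo` reads. -/
theorem horo_G1 (y : Octonion ℝ) (X : J) : horo (G1 y X) = 0 := by
  simp only [horo_apply, G1_apply, h1_coords, Octonion.inner_def, Octonion.coords_one,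
    Octonion.coords_zero,
    Octonion.coords, quaternion_coords]
  ring1

theorem horo_G2 {q : Octonion ℝ} (hq : q ∈ Octonion.Im) (X : J) : horo (G2 q X) = 0 := by
  have q₀ : q.1.re = 0 := hq
  simp only [horo_apply, G2_apply hq, h1_coords, Octonion.inner_def, Octonion.coords_one,
    Octonion.coords_zero,
    Octonion.coords, quaternion_coords, q₀]
  ring1

/-- Wherever `horo` is nonzero, a suitable `y` therefore moves the weight -1 coordinate to any
prescribed value; `imCoord_G2` does the same for the imaginary part. -/
theorem lowCoord_G1 (y : Octonion ℝ) (X : J) : lowCoord (G1 y X) = horo X • y := by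
  simp only [lowCoord_apply, horo_apply, G1_apply, h1_coords, Octonion.inner_def]
  apply Octonion.ext <;> apply Quaternion.ext <;>
  simp only [Octonion.coords_one, Octonion.coords_zero,
    Octonion.coords, quaternion_coords] <;> ring1

theorem lowCoord_G2 {q : Octonion ℝ} (hq : q ∈ Octonion.Im) (X : J) : lowCoord (G2 q X) = 0 := by
  have q₀ : q.1.re = 0 := hq
  simp only [lowCoord_apply, G2_apply hq, h1_coords, Octonion.inner_def]
  apply Octonion.ext <;> apply Quaternion.ext <;>
  simp only [Octonion.coords_one, Octonion.coords_zero,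
    Octonion.coords, quaternion_coords, q₀] <;> ring1

theorem imCoord_G2 {q : Octonion ℝ} (hq : q ∈ Octonion.Im) (X : J) :
    imCoord (G2 q X) = horo X • q := by
  have q₀ : q.1.re = 0 := hq
  simp only [imCoord_apply, horo_apply, G2_apply hq, h1_coords, Octonion.inner_def]
  apply Octonion.ext <;> apply Quaternion.ext <;>
  simp only [Octonion.coords_one, Octonion.coords_zero,
    Octonion.coords, quaternion_coords, q₀] <;> ring1

theorem horo_A3_one (X : J) : horo (A3 1 X) = -2 * horo X := by
  simp only [horo_apply, A3_apply, h1_coords, Octonion.inner_def, Octonion.coords_one,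
    Octonion.coords_zero,
    Octonion.coords, quaternion_coords]
  ring1

theorem opHoro_A3_one (X : J) : opHoro (A3 1 X) = 2 * opHoro X := by
  simp only [opHoro_apply, A3_apply, h1_coords, Octonion.inner_def, Octonion.coords_one,
    Octonion.coords_zero,
    Octonion.coords, quaternion_coords]
  ring1

theorem diagForm_A3_one (X : J) : diagForm (A3 1 X) = 0 := by
  simp only [diagForm_apply, A3_apply, h1_coords, Octonion.inner_def, Octonion.coords_one,
    Octonion.coords_zero,
    Octonion.coords, quaternion_coords]
  ring1

theorem lowCoord_A3_one (X : J) : lowCoord (A3 1 X) = (-1 : ℝ) • lowCoord X := by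
  simp only [lowCoord_apply, A3_apply, h1_coords, Octonion.inner_def]
  apply Octonion.ext <;> apply Quaternion.ext <;>
  simp only [Octonion.coords_one, Octonion.coords_zero,
    Octonion.coords, quaternion_coords] <;> ring1

theorem highCoord_A3_one (X : J) : highCoord (A3 1 X) = (1 : ℝ) • highCoord X := by
  simp only [highCoord_apply, A3_apply, h1_coords, Octonion.inner_def]
  apply Octonion.ext <;> apply Quaternion.ext <;>
  simp only [Octonion.coords_one, Octonion.coords_zero,
    Octonion.coords, quaternion_coords] <;> ring1

theorem imCoord_A3_one (X : J) : imCoord (A3 1 X) = 0 := by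
  simp only [imCoord_apply, A3_apply, h1_coords, Octonion.inner_def]
  apply Octonion.ext <;> apply Quaternion.ext <;>
  simp only [Octonion.coords_one, Octonion.coords_zero,
    Octonion.coords, quaternion_coords] <;> ring1

theorem traceForm_A1 (a : Octonion ℝ) (X : J) : traceForm (A1 a X) = 0 := by
  simp only [traceForm_apply, A1_apply, h1_coords, Octonion.inner_def, Octonion.coords_one,
    Octonion.coords_zero,
    Octonion.coords, quaternion_coords]
  ring1

theorem traceForm_A2 (a : Octonion ℝ) (X : J) : traceForm (A2 a X) = 0 := by
  simp only [traceForm_apply, A2_apply, h1_coords, Octonion.inner_def, Octonion.coords_one,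
    Octonion.coords_zero,
    Octonion.coords, quaternion_coords]
  ring1

theorem traceForm_A3 (a : Octonion ℝ) (X : J) : traceForm (A3 a X) = 0 := by
  simp only [traceForm_apply, A3_apply, h1_coords, Octonion.inner_def, Octonion.coords_one,
    Octonion.coords_zero,
    Octonion.coords, quaternion_coords]
  ring1

theorem traceForm_delta (a : Octonion ℝ) (X : J) : traceForm (delta a X) = 0 := by
  simp only [traceForm_apply, delta_apply, h1_coords, Octonion.inner_def, Octonion.coords_one,
    Octonion.coords_zero,
    Octonion.coords, quaternion_coords]
  ring1

/-- First link of the chain `horo`, `lowCoord`, `diagForm`, `highCoord`, `opHoro`, 0: precomposing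
with `Gm1 y` passes from each to the next, with octonion coordinates paired against `y`. Five
applications thus annihilate `horo`. -/
theorem horo_Gm1 (y : Octonion ℝ) (X : J) : horo (Gm1 y X) = -4 * inner ℝ y (lowCoord X) := by
  simp only [horo_apply, lowCoord_apply, Gm1_apply, h1_coords, Octonion.inner_def,
    Octonion.coords_one, Octonion.coords_zero,
    Octonion.coords, quaternion_coords]
  ring1

theorem inner_lowCoord_Gm1 (y : Octonion ℝ) (X : J) :
    inner ℝ y (lowCoord (Gm1 y X)) = -(inner ℝ y y * diagForm X) := by
  simp only [diagForm_apply, lowCoord_apply, Gm1_apply, h1_coords, Octonion.inner_def,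
    Octonion.coords_one, Octonion.coords_zero,
    Octonion.coords, quaternion_coords]
  ring1

theorem diagForm_Gm1 (y : Octonion ℝ) (X : J) :
    diagForm (Gm1 y X) = 6 * inner ℝ y (highCoord X) := by
  simp only [diagForm_apply, highCoord_apply, Gm1_apply, h1_coords, Octonion.inner_def,
    Octonion.coords_one, Octonion.coords_zero,
    Octonion.coords, quaternion_coords]
  ring1

theorem inner_highCoord_Gm1 (y : Octonion ℝ) (X : J) :
    inner ℝ y (highCoord (Gm1 y X)) = inner ℝ y y * opHoro X := by
  simp only [opHoro_apply, highCoord_apply, Gm1_apply, h1_coords, Octonion.inner_def,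
    Octonion.coords_one, Octonion.coords_zero,
    Octonion.coords, quaternion_coords]
  ring1

theorem opHoro_Gm1 (y : Octonion ℝ) (X : J) : opHoro (Gm1 y X) = 0 := by
  simp only [opHoro_apply, Gm1_apply, h1_coords, Octonion.inner_def, Octonion.coords_one,
    Octonion.coords_zero,
    Octonion.coords, quaternion_coords]
  ring1

theorem horo_Gm2 {q : Octonion ℝ} (hq : q ∈ Octonion.Im) (X : J) :
    horo (Gm2 q X) = -8 * inner ℝ q (imCoord X) := by
  have q₀ : q.1.re = 0 := hq
  simp only [horo_apply, imCoord_apply, Gm2_apply hq, h1_coords, Octonion.inner_def,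
    Octonion.coords_one, Octonion.coords_zero,
    Octonion.coords, quaternion_coords, q₀]
  ring1

theorem inner_imCoord_Gm2 {q : Octonion ℝ} (hq : q ∈ Octonion.Im) (X : J) :
    inner ℝ q (imCoord (Gm2 q X)) = -(inner ℝ q q * opHoro X) := by
  have q₀ : q.1.re = 0 := hq
  simp only [opHoro_apply, imCoord_apply, Gm2_apply hq, h1_coords, Octonion.inner_def,
    Octonion.coords_one, Octonion.coords_zero,
    Octonion.coords, quaternion_coords, q₀]
  ring1

theorem opHoro_Gm2 {q : Octonion ℝ} (hq : q ∈ Octonion.Im) (X : J) : opHoro (Gm2 q X) = 0 := by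
  have q₀ : q.1.re = 0 := hq
  simp only [opHoro_apply, Gm2_apply hq, h1_coords, Octonion.inner_def, Octonion.coords_one,
    Octonion.coords_zero,
    Octonion.coords, quaternion_coords, q₀]
  ring1

-- In `Gm1 y (Gm1 y X)` the two contributions of x₃ to the third octonion entry are (y|y)x₃ with
-- opposite signs, and the remaining ones are real.
set_option maxHeartbeats 1000000 in
theorem inner_imCoord_Gm1_Gm1 {q : Octonion ℝ} (hq : q ∈ Octonion.Im) (y : Octonion ℝ) (X : J) :
    inner ℝ q (imCoord (Gm1 y (Gm1 y X))) = 0 := by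
  have q₀ : q.1.re = 0 := hq
  simp only [imCoord_apply, Gm1_apply, h1_coords, Octonion.inner_def, Octonion.coords_one,
    Octonion.coords_zero,
    Octonion.coords, quaternion_coords, q₀]
  ring1

/-! ### Membership in the group and inverses. -/

theorem isDerivation_G1 (y : Octonion ℝ) : IsDerivation (G1 y) :=
  (isDerivation_A1 _).add (isDerivation_A2 _)

theorem isDerivation_Gm1 (y : Octonion ℝ) : IsDerivation (Gm1 y) :=
  (isDerivation_A1 _).add (isDerivation_A2 _)

theorem isDerivation_G2 {q : Octonion ℝ} (hq : q ∈ Octonion.Im) : IsDerivation (G2 q) :=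
  (isDerivation_A3 _).sub (isDerivation_delta hq)

theorem isDerivation_Gm2 {q : Octonion ℝ} (hq : q ∈ Octonion.Im) : IsDerivation (Gm2 q) :=
  (isDerivation_A3 _).sub (isDerivation_delta hq)

theorem a_mem_F4 (t : ℝ) : a t ∈ F4 :=
  ((isDerivation_A3 1).smul t).expGL_mem_F4

theorem a_inv (t : ℝ) : (a t)⁻¹ = a (-t) := by
  rw [a, a, ← expGL_neg]
  exact congrArg expGL (neg_smul t (A3 1)).symm

theorem mul_val_apply (g h : GLJ) (X : J) : (g * h).1 X = g.1 (h.1 X) := rfl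

theorem inv_val_apply_val_apply (g : GLJ) (X : J) : (g⁻¹).1 (g.1 X) = X :=
  congrArg (fun f : J →L[ℝ] J => f X) g.inv_mul

theorem val_apply_inv_val_apply (g : GLJ) (X : J) : g.1 ((g⁻¹).1 X) = X :=
  congrArg (fun f : J →L[ℝ] J => f X) g.mul_inv

/-! ### The action on the weight coordinates -/

theorem map_a_of_weight {E : Type*} [NormedAddCommGroup E] [NormedSpace ℝ E]
    {Φ : J →ₗ[ℝ] E} {c : ℝ} (h : ∀ X, Φ (A3 1 X) = c • Φ X) (t : ℝ) (X : J) :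
    Φ ((a t).1 X) = Real.exp (t * c) • Φ X := by
  refine map_expGL_of_weight (fun Y => ?_) X
  change Φ (t • A3 1 Y) = _
  rw [map_smul, h, smul_smul]

theorem horo_a (t : ℝ) (X : J) : horo ((a t).1 X) = Real.exp (-2 * t) * horo X := by
  rw [map_a_of_weight horo_A3_one, mul_comm t, smul_eq_mul]

theorem opHoro_a (t : ℝ) (X : J) : opHoro ((a t).1 X) = Real.exp (2 * t) * opHoro X := by
  rw [map_a_of_weight opHoro_A3_one, mul_comm t, smul_eq_mul]

theorem diagForm_a (t : ℝ) (X : J) : diagForm ((a t).1 X) = diagForm X := by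
  rw [map_a_of_weight (c := 0) (by simpa using diagForm_A3_one)]
  simp

theorem imCoord_a (t : ℝ) (X : J) : imCoord ((a t).1 X) = imCoord X := by
  rw [map_a_of_weight (c := 0) (by simpa using imCoord_A3_one)]
  simp

theorem lowCoord_a (t : ℝ) (X : J) : lowCoord ((a t).1 X) = Real.exp (-t) • lowCoord X := by
  rw [map_a_of_weight lowCoord_A3_one, mul_neg_one]

theorem highCoord_a (t : ℝ) (X : J) : highCoord ((a t).1 X) = Real.exp t • highCoord X := by
  rw [map_a_of_weight highCoord_A3_one, mul_one]

theorem traceForm_G1 (y : Octonion ℝ) (X : J) : traceForm (G1 y X) = 0 := by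
  change traceForm (A1 _ X + A2 _ X) = 0
  rw [map_add, traceForm_A1, traceForm_A2, add_zero]

theorem traceForm_Gm1 (y : Octonion ℝ) (X : J) : traceForm (Gm1 y X) = 0 := by
  change traceForm (A1 _ X + A2 _ X) = 0
  rw [map_add, traceForm_A1, traceForm_A2, add_zero]

theorem traceForm_G2 (q : Octonion ℝ) (X : J) : traceForm (G2 q X) = 0 := by
  change traceForm (A3 _ X - delta _ X) = 0
  rw [map_sub, traceForm_A3, traceForm_delta, sub_zero]

theorem traceForm_Gm2 (q : Octonion ℝ) (X : J) : traceForm (Gm2 q X) = 0 := by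
  change traceForm (A3 _ X - delta _ X) = 0
  rw [map_sub, traceForm_A3, traceForm_delta, sub_zero]

theorem traceForm_a (t : ℝ) (X : J) : traceForm ((a t).1 X) = traceForm X := by
  rw [map_a_of_weight (c := 0) (by simpa using traceForm_A3 1)]
  simp

/-! ### The idempotent `E₁` and its stabilizer -/

/-- The primitive idempotent `E₁`. -/
noncomputable def E1 : J := h1 1 0 0 0 0 0

theorem jordan_E1 (X : J) : jordan E1 X =
    h1 (X.1 0) 0 0 0 ((1 / 2 : ℝ) • X.2 1) ((1 / 2 : ℝ) • X.2 2) := by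
  apply J_ext <;> simp [jordan, E1, Octonion.star_zero']

theorem jordan_E1_E1 : jordan E1 E1 = E1 := by
  rw [jordan_E1]; apply J_ext <;> simp [E1, h1_coords]

theorem sigma_apply (X : J) :
    sigma.1 X = h1 (X.1 0) (X.1 1) (X.1 2) (X.2 0) (-X.2 1) (-X.2 2) := rfl

/-- Multiplication by `E1` has eigenvalues 0, 1/2, 1, and 1 - 8λ + 8λ² takes the values 1, -1, 1
there. Thus an automorphism fixing `E1` commutes with `sigma`. -/
theorem sigma_apply_eq (X : J) :
    sigma.1 X = X - (8 : ℝ) • jordan E1 X + (8 : ℝ) • jordan E1 (jordan E1 X) := by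
  rw [sigma_apply, jordan_E1, jordan_E1]
  apply J_ext <;> simp only [h1_coords, Prod.fst_add, Prod.snd_add, Prod.fst_sub, Prod.snd_sub,
    Prod.smul_fst, Prod.smul_snd, Pi.add_apply, Pi.sub_apply, Pi.smul_apply, smul_eq_mul] <;>
    first | ring1 | module

theorem mem_K_of_apply_E1 {k : GLJ} (hk : k ∈ F4) (hE : k.1 E1 = E1) : k ∈ K := by
  refine ⟨hk, ?_⟩
  rw [mul_inv_eq_iff_eq_mul]
  refine Units.ext (ContinuousLinearMap.ext fun X => ?_)
  change sigma.1 (k.1 X) = k.1 (sigma.1 X)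
  have hk' : ∀ Y, k.1 (jordan E1 Y) = jordan E1 (k.1 Y) := fun Y => by rw [hk, hE]
  rw [sigma_apply_eq, sigma_apply_eq, map_add, map_sub, map_smul, map_smul, hk', hk', hk']

theorem Octonion.eq_zero_of_neg_eq {y : Octonion ℝ} (h : -y = y) : y = 0 := by
  have h2 : (2 : ℝ) • y = 0 := by
    rw [two_smul]
    nth_rewrite 1 [← h]
    exact neg_add_cancel y
  exact (smul_eq_zero.1 h2).resolve_left two_ne_zero

theorem eq_of_sigma_eq {X : J} (h : sigma.1 X = X) : X.2 1 = 0 ∧ X.2 2 = 0 := by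
  rw [sigma_apply] at h
  exact ⟨Octonion.eq_zero_of_neg_eq (congrArg (fun Z : J => Z.2 1) h),
    Octonion.eq_zero_of_neg_eq (congrArg (fun Z : J => Z.2 2) h)⟩

theorem jordan_E1_of_sigma_eq_neg {X : J} (h : sigma.1 X = -X) :
    jordan E1 X = (1 / 2 : ℝ) • X := by
  rw [sigma_apply] at h
  have e0 := congrArg (fun Z : J => Z.1 0) h
  have e1 := congrArg (fun Z : J => Z.1 1) h
  have e2 := congrArg (fun Z : J => Z.1 2) h
  have e3 : X.2 0 = 0 := Octonion.eq_zero_of_neg_eq (congrArg (fun Z : J => Z.2 0) h).symm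
  simp only [h1_coords, Prod.fst_neg, Pi.neg_apply] at e0 e1 e2
  rw [jordan_E1]
  apply J_ext <;> simp only [h1_coords, Prod.smul_fst, Prod.smul_snd, Pi.smul_apply,
    smul_eq_mul, e3, smul_zero] <;> linarith

/-- Since `k` preserves the eigenspaces of `sigma`, the image u of `E1` acts on them as `E1` does:
by 1/2 on the odd part, and into the line of u on the even part. The first property leaves only `E1`
and its complement 1 - E₁; the second excludes the complement. -/
theorem apply_E1_of_mem_K {k : GLJ} (hk : k ∈ K) : k.1 E1 = E1 := by
  obtain ⟨hk, hσ⟩ := hk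
  have hcomm : ∀ X, sigma.1 (k.1 X) = k.1 (sigma.1 X) := fun X => by
    rw [mul_inv_eq_iff_eq_mul] at hσ
    exact congrArg (fun g : GLJ => g.1 X) hσ
  have hcomm' : ∀ X, sigma.1 ((k⁻¹).1 X) = (k⁻¹).1 (sigma.1 X) := fun X => by
    rw [← inv_val_apply_val_apply k (sigma.1 ((k⁻¹).1 X)), ← hcomm, val_apply_inv_val_apply]
  have hk' : ∀ Y, jordan (k.1 E1) Y = k.1 (jordan E1 ((k⁻¹).1 Y)) := fun Y => by
    rw [hk, val_apply_inv_val_apply]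
  have hid : jordan (k.1 E1) (k.1 E1) = k.1 E1 := by rw [← hk, jordan_E1_E1]
  have hodd : ∀ Y : J, sigma.1 Y = -Y → jordan (k.1 E1) Y = (1 / 2 : ℝ) • Y := by
    intro Y hY
    rw [hk', jordan_E1_of_sigma_eq_neg (by rw [hcomm', hY, map_neg]), map_smul,
      val_apply_inv_val_apply]
  have heven : ∀ Y : J, sigma.1 Y = Y → ∃ c : ℝ, jordan (k.1 E1) Y = c • k.1 E1 := by
    intro Y hY
    obtain ⟨h1, h2⟩ := eq_of_sigma_eq (X := (k⁻¹).1 Y) (by rw [hcomm', hY])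
    refine ⟨((k⁻¹).1 Y).1 0, ?_⟩
    rw [hk', jordan_E1, h1, h2, ← map_smul]
    congr 1
    apply J_ext <;> simp [E1]
  have hfix : sigma.1 (k.1 E1) = k.1 E1 := by
    rw [hcomm, sigma_apply]
    congr 1
    apply J_ext <;> simp [E1]
  generalize k.1 E1 = u at hid hodd heven hfix
  obtain ⟨hu1, hu2⟩ := eq_of_sigma_eq hfix
  have hY2 := hodd (h1 0 0 0 0 1 0) (by rw [sigma_apply]; apply J_ext <;> simp)
  have hY3 := hodd (h1 0 0 0 0 0 1) (by rw [sigma_apply]; apply J_ext <;> simp)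
  obtain ⟨c, hc⟩ := heven (h1 0 1 0 0 0 0) (by rw [sigma_apply]; apply J_ext <;> simp)
  have a1 := congrArg (fun Z : J => (Z.2 1).1.re) hY2
  have a2 := congrArg (fun Z : J => Z.2 2) hY2
  have a3 := congrArg (fun Z : J => (Z.2 2).1.re) hY3
  have a4 := congrArg (fun Z : J => Z.1 0) hid
  have a5 := congrArg (fun Z : J => Z.1 1) hc
  have a6 := congrArg (fun Z : J => Z.1 2) hc
  simp [jordan, hu1, hu2, Octonion.star_zero'] at a1 a2 a3 a4 a5 a6
  -- The odd tests give ξ₁ + ξ₂ = ξ₁ + ξ₃ = 1 and x₁ = 0, and idempotency gives ξ₁² = ξ₁. If ξ₁ = 0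
  -- then u = diag(0, 1, 1), whose product with diag(0, 1, 0) is not a multiple of u.
  have hx : u.2 0 = 0 := by rw [← Octonion.star_star' (u.2 0), a2, Octonion.star_zero']
  have h0 : u.1 0 = 1 := by
    rcases mul_eq_zero.1 (show u.1 0 * (u.1 0 - 1) = 0 by linear_combination a4) with h | h
    · have h1 : u.1 1 = 1 := by linarith
      have h2 : u.1 2 = 1 := by linarith
      rw [h1, mul_one] at a5
      rw [h2, ← a5] at a6
      simp at a6
    · linarith
  apply J_ext <;> simp [E1, hx, hu1, hu2] <;> linarith

/-! ### Transitivity of `A N⁺` on idempotents of trace one -/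

theorem eq_E1_of_jordan_self {u : J} (hid : jordan u u = u) (htr : traceForm u = 1)
    (hh : horo u = 1) (hl : lowCoord u = 0) (hi : imCoord u = 0) : u = E1 := by
  rw [traceForm_apply] at htr
  rw [horo_apply] at hh
  rw [lowCoord_apply, sub_eq_zero] at hl
  rw [imCoord_apply, sub_eq_zero] at hi
  obtain ⟨r, hr⟩ : ∃ r : ℝ, r = inner ℝ 1 (u.2 2) := ⟨_, rfl⟩
  obtain ⟨b, hb⟩ : ∃ b, b = u.2 1 := ⟨_, rfl⟩
  rw [← hr] at hi hh
  rw [← hb] at hl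
  have hb2 : ∀ x : Octonion ℝ, inner ℝ (star x) (star x) = (inner ℝ x x : ℝ) := fun x =>
    Octonion.inner_star_star x x
  have h11 : inner ℝ (1 : Octonion ℝ) (1 : Octonion ℝ) = (1 : ℝ) := by
    simp only [Octonion.inner_def, Octonion.coords_one]
    norm_num
  have hbb : inner ℝ (1 : Octonion ℝ) (star b * b) = (inner ℝ b b : ℝ) := by
    simp only [Octonion.inner_def, Octonion.coords_one, Octonion.coords, quaternion_coords]
    ring
  have e0 := congrArg (fun Z : J => Z.1 0) hid
  have e1 := congrArg (fun Z : J => Z.1 1) hid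
  have e4 := congrArg (fun Z : J => inner ℝ 1 (Z.2 2)) hid
  simp only [jordan, h1_coords, hi, hl, ← hb, inner_smul_left, inner_smul_right, h11, hb2,
    RCLike.conj_to_real, inner_add_right, mul_one, Octonion.star_mul', Octonion.star_smul',
    Octonion.star_star', smul_mul_assoc, mul_smul_comm, one_mul, hbb]
    at e0 e1 e4
  -- The combination of entries makes the terms in `b` cancel and leaves (ξ₁ + ξ₂) `horo u` = `horo
  -- u`, with `horo u = 1`.
  have hsum : u.1 0 + u.1 1 = 1 := by
    linear_combination (-(u.1 0 + u.1 1 - 1)) * hh + e0 - e1 + 2 * e4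
  have hb0 : (inner ℝ b b : ℝ) = 0 := by linear_combination e4 - r * hsum
  have hr1 : r = 1 - u.1 0 := by linarith
  have h0 : u.1 0 = 1 := by linear_combination e0 + hb0 + (r + (1 - u.1 0)) * hr1
  have hr0 : r = 0 := by rw [hr1, h0, sub_self]
  rw [inner_self_eq_zero.1 hb0] at hl hb
  apply J_ext <;> simp [E1, hl, ← hb, hi, hr0, Octonion.star_zero'] <;> linarith

theorem exists_a_mul_Nplus_apply_eq_E1 {v : J} (hid : jordan v v = v) (htr : traceForm v = 1)
    {s : ℝ} (hv : horo v = Real.exp (2 * s)) : ∃ n ∈ Nplus, (a s * n).1 v = E1 := by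
  have hne : horo v ≠ 0 := by rw [hv]; exact (Real.exp_pos _).ne'
  -- On `lowCoord` the exponential of `G1 y` is the translation by `horo v • y`; this `y` solves for
  -- zero. The choice of `q` below is the same for `imCoord`, and it leaves `lowCoord` untouched.
  obtain ⟨y, hy⟩ : ∃ y, y = -((horo v)⁻¹ • lowCoord v) := ⟨_, rfl⟩
  obtain ⟨w, hw⟩ : ∃ w, w = (expGL (G1 y)).1 v := ⟨_, rfl⟩
  have hwh : horo w = horo v := by rw [hw, map_expGL_of_map_eq_zero (horo_G1 y)]
  have hwl : lowCoord w = 0 := by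
    rw [hw, map_expGL_of_map_map_eq_zero, lowCoord_G1, hy, smul_neg, smul_smul,
      mul_inv_cancel₀ hne, one_smul, add_neg_cancel]
    intro X
    rw [lowCoord_G1, horo_G1, zero_smul]
  obtain ⟨q, hq⟩ : ∃ q, q = -((horo v)⁻¹ • imCoord w) := ⟨_, rfl⟩
  have hqIm : q ∈ Octonion.Im := by
    change q.1.re = 0
    rw [hq, imCoord_apply]
    simp [Octonion.inner_def]
  have hn : expGL (G1 y + G2 q) = expGL (G2 q) * expGL (G1 y) := by
    rw [add_comm, expGL_add (commute_G1_G2 y hqIm).symm]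
  obtain ⟨u, hu⟩ : ∃ u, u = (expGL (G2 q)).1 w := ⟨_, rfl⟩
  have hav : (a s * expGL (G1 y + G2 q)).1 v = (a s).1 u := by
    rw [hn, hu, hw]; rfl
  have hF : a s * expGL (G1 y + G2 q) ∈ F4 := F4.mul_mem (a_mem_F4 s)
    ((isDerivation_G1 y).add (isDerivation_G2 hqIm)).expGL_mem_F4
  refine ⟨_, ⟨y, q, hqIm, rfl⟩, eq_E1_of_jordan_self ?_ ?_ ?_ ?_ ?_⟩
  · rw [← hF, hid]
  · rw [hav, traceForm_a, hu, map_expGL_of_map_eq_zero (traceForm_G2 q), hw,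
      map_expGL_of_map_eq_zero (traceForm_G1 y), htr]
  · rw [hav, horo_a, hu, map_expGL_of_map_eq_zero (horo_G2 hqIm), hwh, hv, ← Real.exp_add]
    simp
  · rw [hav, lowCoord_a, hu, map_expGL_of_map_eq_zero (lowCoord_G2 hqIm), hwl, smul_zero]
  · rw [hav, imCoord_a, hu, map_expGL_of_map_map_eq_zero, imCoord_G2 hqIm, hwh, hq, smul_neg,
      smul_smul, mul_inv_cancel₀ hne, one_smul, add_neg_cancel]
    intro X
    rw [imCoord_G2 hqIm, horo_G2 hqIm, zero_smul]

/-! ### The Iwasawa component -/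

theorem horo_E1 : horo E1 = 1 := by simp [horo_apply, E1]

/-- If `a s * n` carries g⁻¹E₁ to `E1`, then g (aₛ n)⁻¹ fixes `E1` and serves as the factor in `K`.
-/
theorem isIwasawaComponent_smul {g : GLJ} (hg : g ∈ F4) (htr : traceForm ((g⁻¹).1 E1) = 1)
    {s : ℝ} (hs : horo ((g⁻¹).1 E1) = Real.exp (2 * s)) :
    IsIwasawaComponent g (s • A3 1) := by
  obtain ⟨n, hn, hnE⟩ := exists_a_mul_Nplus_apply_eq_E1
    (by rw [← F4.inv_mem hg, jordan_E1_E1]) htr hs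
  obtain ⟨y, q, hq, rfl⟩ := hn
  have hnF : expGL (G1 y + G2 q) ∈ F4 :=
    ((isDerivation_G1 y).add (isDerivation_G2 hq)).expGL_mem_F4
  refine ⟨Submodule.smul_mem _ _ (Submodule.mem_span_singleton_self _),
    g * (a s * expGL (G1 y + G2 q))⁻¹, ?_, _, ⟨y, q, hq, rfl⟩, ?_⟩
  · refine mem_K_of_apply_E1 (F4.mul_mem hg (F4.inv_mem (F4.mul_mem (a_mem_F4 s) hnF))) ?_
    conv_lhs => rw [mul_val_apply, ← hnE, inv_val_apply_val_apply, val_apply_inv_val_apply]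
  · change g = g * (a s * expGL (G1 y + G2 q))⁻¹ * a s * expGL (G1 y + G2 q)
    rw [mul_assoc, inv_mul_cancel_right]

theorem horo_inv_apply_E1_of_isIwasawaComponent {g : GLJ} {s : ℝ}
    (h : IsIwasawaComponent g (s • A3 1)) : horo ((g⁻¹).1 E1) = Real.exp (2 * s) := by
  obtain ⟨-, k, hk, n, ⟨y, q, hq, rfl⟩, rfl⟩ := h
  have hkE : (k⁻¹).1 E1 = E1 := by
    conv_lhs => rw [← apply_E1_of_mem_K hk, inv_val_apply_val_apply]
  have hfix : ∀ X, horo ((expGL (G1 y + G2 q)).1 X) = horo X :=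
    map_expGL_of_map_eq_zero fun X => by
      change horo (G1 y X + G2 q X) = 0
      rw [map_add, horo_G1, horo_G2 hq, add_zero]
  rw [← hfix, ← mul_val_apply, mul_inv_rev, mul_inv_cancel_left, mul_inv_rev, mul_val_apply, hkE]
  change horo ((a s)⁻¹.1 E1) = _
  rw [a_inv, horo_a, horo_E1, mul_one, neg_mul_neg]

theorem isIwasawaComponent_iff {g : GLJ} (hg : g ∈ F4) (htr : traceForm ((g⁻¹).1 E1) = 1)
    {c : ℝ} (hc : 0 < c) (hgc : horo ((g⁻¹).1 E1) = c) (Y : J →L[ℝ] J) :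
    IsIwasawaComponent g Y ↔ Y = (2⁻¹ * Real.log c) • A3 1 := by
  constructor
  · intro h
    obtain ⟨s, rfl⟩ := Submodule.mem_span_singleton.1 h.1
    have h1 := horo_inv_apply_E1_of_isIwasawaComponent h
    rw [← hgc, h1, Real.log_exp, inv_mul_cancel_left₀ two_ne_zero]
  · rintro rfl
    refine isIwasawaComponent_smul hg htr ?_
    rw [mul_inv_cancel_left₀ two_ne_zero, Real.exp_log hc, hgc]

theorem existsUnique_and_H_eq {g : GLJ} (hg : g ∈ F4) (htr : traceForm ((g⁻¹).1 E1) = 1)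
    {c : ℝ} (hc : 0 < c) (hgc : horo ((g⁻¹).1 E1) = c) :
    (∃! Y, IsIwasawaComponent g Y) ∧ H g = (2⁻¹ * Real.log c) • A3 1 := by
  have h := isIwasawaComponent_iff hg htr hc hgc
  have hex : ∃ Y, IsIwasawaComponent g Y := ⟨_, (h _).2 rfl⟩
  refine ⟨⟨_, (h _).2 rfl, fun Y hY => (h Y).1 hY⟩, ?_⟩
  rw [H, dif_pos hex]
  exact (h _).1 hex.choose_spec

/-! ### The value on `A N⁻` -/

theorem Gm1_neg (x : Octonion ℝ) : -Gm1 x = Gm1 (-x) := by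
  refine ContinuousLinearMap.ext fun X => ?_
  change -(Gm1 x X) = _
  rw [Gm1_apply, Gm1_apply]
  apply J_ext <;> simp [Octonion.star_neg'] <;> first | ring1 | abel

theorem Gm2_neg {p : Octonion ℝ} (hp : p ∈ Octonion.Im) : -Gm2 p = Gm2 (-p) := by
  have hp' : -p ∈ Octonion.Im := by
    change (-p).1.re = 0
    rw [Octonion.neg_fst, Quaternion.re_neg, show p.1.re = 0 from hp, neg_zero]
  refine ContinuousLinearMap.ext fun X => ?_
  change -(Gm2 p X) = _
  rw [Gm2_apply hp, Gm2_apply hp']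
  apply J_ext <;> simp <;> first | ring1 | abel

/-- The chain of weight coordinates ends after `opHoro`, so the series has degree 4. -/
theorem horo_expGL_Gm1 (y : Octonion ℝ) (X : J) : horo ((expGL (Gm1 y)).1 X) =
    horo X - 4 * inner ℝ y (lowCoord X) + 2 * inner ℝ y y * diagForm X
      + 4 * inner ℝ y y * inner ℝ y (highCoord X) + inner ℝ y y ^ 2 * opHoro X := by
  have h1 : ∀ X, horo (Gm1 y X) = -4 * inner ℝ y (lowCoord X) := horo_Gm1 y
  have h2 : ∀ X, horo (Gm1 y (Gm1 y X)) = 4 * inner ℝ y y * diagForm X := fun X => by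
    rw [h1, inner_lowCoord_Gm1]; ring
  have h3 : ∀ X, horo (Gm1 y (Gm1 y (Gm1 y X))) =
      24 * inner ℝ y y * inner ℝ y (highCoord X) := fun X => by
    rw [h2, diagForm_Gm1]; ring
  have h4 : ∀ X, horo (Gm1 y (Gm1 y (Gm1 y (Gm1 y X)))) =
      24 * inner ℝ y y ^ 2 * opHoro X := fun X => by
    rw [h3, inner_highCoord_Gm1]; ring
  rw [map_expGL_eq_sum 5 (fun X => ?_) X]
  · simp only [Finset.sum_range_succ, Finset.sum_range_zero, pow_succ, pow_zero,
      mul_apply_eq_comp, one_apply_eq_self, one_mul, smul_eq_mul, Nat.factorial]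
    rw [h4, h3, h2, h1]
    push_cast
    ring
  · simp only [pow_succ, pow_zero, one_mul, mul_apply_eq_comp]
    rw [h4, opHoro_Gm1, mul_zero]

theorem horo_expGL_Gm2 {q : Octonion ℝ} (hq : q ∈ Octonion.Im) (X : J) :
    horo ((expGL (Gm2 q)).1 X) =
      horo X - 8 * inner ℝ q (imCoord X) + 4 * inner ℝ q q * opHoro X := by
  have h2 : ∀ X, horo (Gm2 q (Gm2 q X)) = 8 * inner ℝ q q * opHoro X := fun X => by
    rw [horo_Gm2 hq, inner_imCoord_Gm2 hq]; ring
  rw [map_expGL_eq_sum 3 (fun X => ?_) X]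
  · simp only [Finset.sum_range_succ, Finset.sum_range_zero, pow_succ, pow_zero,
      mul_apply_eq_comp, one_apply_eq_self, one_mul, horo_Gm2 hq, inner_imCoord_Gm2 hq,
      smul_eq_mul, Nat.factorial]
    push_cast
    ring
  · simp only [pow_succ, pow_zero, one_mul, mul_apply_eq_comp]
    rw [h2, opHoro_Gm2 hq, mul_zero]

theorem inner_imCoord_expGL_Gm1 {q : Octonion ℝ} (hq : q ∈ Octonion.Im) (y : Octonion ℝ) (X : J) :
    inner ℝ q (imCoord ((expGL (Gm1 y)).1 X)) =
      inner ℝ q (imCoord X) + (inner ℝ q (imCoord (Gm1 y X)) : ℝ) :=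
  map_expGL_of_map_map_eq_zero (Φ := (innerₗ (Octonion ℝ) q).comp imCoord)
    (inner_imCoord_Gm1_Gm1 hq y) X

/-- At a₋ₜE₁ only the forms of even weight survive: `horo`, `diagForm`, `opHoro` are e²ᵗ, 1, e⁻²ᵗ.
The factor from `x` gives e²ᵗ + 2(x|x) + e⁻²ᵗ(x|x)², a perfect square times e⁻²ᵗ, and the factor
from `p` adds 4e⁻²ᵗ(p|p). -/
theorem horo_inv_apply_a_apply_E1 {p : Octonion ℝ} (hp : p ∈ Octonion.Im) (x : Octonion ℝ)
    (t : ℝ) : horo (((expGL (Gm2 p + Gm1 x))⁻¹).1 ((a (-t)).1 E1)) =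
      Real.exp (-2 * t) * ((Real.exp (2 * t) + inner ℝ x x) ^ 2 + 4 * inner ℝ p p) := by
  have hp' : -p ∈ Octonion.Im := by
    change (-p).1.re = 0
    rw [Octonion.neg_fst, Quaternion.re_neg, show p.1.re = 0 from hp, neg_zero]
  obtain ⟨v, hv⟩ : ∃ v, v = (a (-t)).1 E1 := ⟨_, rfl⟩
  have v1 : horo v = Real.exp (2 * t) := by rw [hv, horo_a, horo_E1, neg_mul_neg, mul_one]
  have v2 : opHoro v = Real.exp (-2 * t) := by
    rw [hv, opHoro_a, mul_neg, neg_mul]; simp [opHoro_apply, E1]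
  have v3 : diagForm v = 1 := by rw [hv, diagForm_a]; simp [diagForm_apply, E1]
  have v4 : lowCoord v = 0 := by
    rw [hv, lowCoord_a]; simp [lowCoord_apply, E1, Octonion.star_zero']
  have v5 : highCoord v = 0 := by
    rw [hv, highCoord_a]; simp [highCoord_apply, E1, Octonion.star_zero']
  -- This and the next fact remove the cross term linear in `p`.
  have v6 : inner ℝ (-p) (imCoord v) = (0 : ℝ) := by
    rw [hv, imCoord_a]; simp [imCoord_apply, E1]
  have v7 : inner ℝ (-p) (imCoord (Gm1 (-x) v)) = (0 : ℝ) := by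
    have h0 : v.2 0 = 0 := by
      have h := congrArg₂ (· + ·) v4 v5
      simp only [lowCoord_apply, highCoord_apply, sub_add_add_cancel, add_zero] at h
      rw [← two_smul ℝ] at h
      exact (smul_eq_zero.1 h).resolve_left two_ne_zero
    have h1 : star (v.2 1) = 0 := by simpa [highCoord_apply, h0] using v5
    rw [imCoord_apply, Gm1_apply]
    simp [h0, h1, Octonion.star_zero']
  have v8 : opHoro ((expGL (Gm1 (-x))).1 v) = opHoro v :=
    map_expGL_of_map_eq_zero (opHoro_Gm1 (-x)) v
  have hexp : Real.exp (-2 * t) * Real.exp (2 * t) = 1 := by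
    rw [← Real.exp_add]; simp
  rw [← hv, ← expGL_neg, neg_add, Gm1_neg, Gm2_neg hp,
    expGL_add (commute_Gm1_Gm2 (-x) hp').symm, mul_val_apply, horo_expGL_Gm2 hp',
    inner_imCoord_expGL_Gm1 hp', v6, v7, v8, horo_expGL_Gm1, v1, v2, v3, v4, v5]
  simp only [inner_zero_right, inner_neg_neg]
  linear_combination (-(Real.exp (2 * t)) - 2 * inner ℝ x x) * hexp

theorem traceForm_inv_apply {p : Octonion ℝ} (x : Octonion ℝ) (X : J) :
    traceForm (((expGL (Gm2 p + Gm1 x))⁻¹).1 X) = traceForm X := by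
  rw [← expGL_neg]
  refine map_expGL_of_map_eq_zero (fun Y => ?_) X
  change traceForm (-(Gm2 p Y + Gm1 x Y)) = 0
  rw [map_neg, map_add, traceForm_Gm1, traceForm_Gm2, add_zero, neg_zero]

end F4Iwasawa

open F4Iwasawa in
theorem lemmaA1 (t : ℝ) (p x : F4Iwasawa.Octonion ℝ) (hp : p ∈ F4Iwasawa.Octonion.Im)
    (z : F4Iwasawa.GLJ) (hz : z = F4Iwasawa.expGL (F4Iwasawa.Gm2 p + F4Iwasawa.Gm1 x)) :
    (F4Iwasawa.a t * z ∈ F4Iwasawa.F4 ∧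
      (∃! Y, F4Iwasawa.IsIwasawaComponent (F4Iwasawa.a t * z) Y) ∧
      F4Iwasawa.H (F4Iwasawa.a t * z) =
        (2⁻¹ * Real.log (Real.exp (-2 * t) *
          ((Real.exp (2 * t) + inner ℝ x x) ^ 2 + 4 * inner ℝ p p))) • F4Iwasawa.A3 1) ∧
    (z ∈ F4Iwasawa.F4 ∧
      (∃! Y, F4Iwasawa.IsIwasawaComponent z Y) ∧
      F4Iwasawa.H z =
        (2⁻¹ * Real.log ((1 + inner ℝ x x) ^ 2 + 4 * inner ℝ p p)) • F4Iwasawa.A3 1) := by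
  subst hz
  have hzF := ((isDerivation_Gm2 hp).add (isDerivation_Gm1 x)).expGL_mem_F4
  have htrE : traceForm E1 = 1 := by simp [traceForm_apply, E1]
  -- These bounds make the argument of the logarithm strictly positive, as the existence of the
  -- decomposition requires.
  have hxx : 0 ≤ (inner ℝ x x : ℝ) := real_inner_self_nonneg
  have hpp : 0 ≤ (inner ℝ p p : ℝ) := real_inner_self_nonneg
  have ha : ∀ t : ℝ, (a t * expGL (Gm2 p + Gm1 x))⁻¹.1 E1 =
      ((expGL (Gm2 p + Gm1 x))⁻¹).1 ((a (-t)).1 E1) := fun t => by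
    rw [mul_inv_rev, mul_val_apply, a_inv]
  have key : ∀ t : ℝ, a t * expGL (Gm2 p + Gm1 x) ∈ F4 ∧
      (∃! Y, IsIwasawaComponent (a t * expGL (Gm2 p + Gm1 x)) Y) ∧
      H (a t * expGL (Gm2 p + Gm1 x)) = (2⁻¹ * Real.log (Real.exp (-2 * t) *
          ((Real.exp (2 * t) + inner ℝ x x) ^ 2 + 4 * inner ℝ p p))) • A3 1 := fun t => by
    have hF := F4.mul_mem (a_mem_F4 t) hzF
    refine ⟨hF, existsUnique_and_H_eq hF ?_ (by positivity) ?_⟩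
    · rw [ha, traceForm_inv_apply, traceForm_a, htrE]
    · rw [ha, horo_inv_apply_a_apply_E1 hp]
  refine ⟨key t, ?_⟩
  have h0 := key 0
  have ha0 : a 0 = 1 := 
    (congrArg expGL (zero_smul ℝ (A3 1))).trans (Units.ext (exp_zero_clm (E := J)))
  simpa [ha0] using h0
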